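/- Setting. Let $N\ge 2$, $1\le M\le N$. $M$ agents choose among $N$ arms at times $t=1,2,\dots$. If agent $k$ chooses arm $i$ at time $t$, the realized reward is $r_i^k(t)$, which has law $p_i$ with mean $m_i\ge 0$. The law is sub-Gaussian: $\ln\mathbb E[e^{\beta r_i^k(t)}]\le m_i\beta+\sigma_g^2\beta^2/2$ for all $\beta\in\mathbb R$, where $\sigma_g>0$. The vectors $(r_i^k(t))_{i\le N}$ are independent over all pairs $(t,k)$. The means are pairwise different, $m_{b^1}>m_{b^2}>\dots>m_{b^N}$; put $i^*=b^1$ and $\Delta_{\min}=\min_{i\ne j}|m_i-m_j|$. In the constrained model an agent receives the realized reward only if no other agent chooses the same arm at that time, and nothing otherwise (it still observes the realized value). Let $i^k(t)$ be the arm chosen by agent $k$ at time $t$, and let $\mathbb I_i^k(t)=1$ if agent $k$ is the only agent that chooses arm $i$ at time $t$, and $0$ otherwise. The expected cumulative regret of the group and of agent $k$ are $$R^{\mathrm{con}}(T)=T\sum_{k=1}^M m_{b^k}-\mathbb E\sum_{t=1}^T\sum_{k=1}^M m_{i^k(t)}\mathbb I_{i^k(t)}^k(t),\qquad R^k(T)=\sum_{t=1}^T\Big(m_{b^k}-\mathbb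 E\sum_{i=1}^N r_i^k(t)\mathbf 1\{i^k(t)=i\}\mathbb I_i^k(t)\Big).$$ Communication. The agents are the nodes of a connected undirected graph with Laplacian $L$ and maximal degree $d_{\max}$. Let $P=I-\frac{\kappa}{d_{\max}}L$ with $0<\kappa\le1$ ($P=I$ if $M=1$), with eigenvalues $1=\lambda_1>\lambda_2\ge\dots\ge\lambda_M$, where $\lambda_M>-1$ is assumed, and orthonormal eigenvectors $u_1,\dots,u_M$ with entries $u_p^d$. Put $$\epsilon_n=\sqrt M\sum_{p=2}^M\frac{|\lambda_p|}{1-|\lambda_p|},\qquad \epsilon_c^k=M\sum_{p=1}^M\sum_{j=2}^M\frac{|\lambda_p\lambda_j|}{1-|\lambda_p\lambda_j|}a_{pj}(k).$$ Here, with $\nu^{\pm}_{pj}$ the sum of the positive (respectively negative) numbers among $u_p^du_j^d$, $d=1,\dots,M$: $a_{pj}(k)=\max\{|\nu^-_{pj}|,\nu^+_{pj}\}\,|u_p^ku_j^k|$ if $\lambda_p\lambda_j<0$; otherwise $a_{pj}(k)=\nu^+_{pj}u_p^ku_j^k$ if $u_p^ku_j^k\ge0$, and $a_{pj}(k)=\nu^-_{pj}u_p^ku_j^k$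 if $u_p^ku_j^k\le0$. Algorithm (coop-UCB2-selective-learning). Let $\gamma>1$, $\eta\in(0,4)$, $G(\eta)=1-\eta^2/16$. Let $f$ be strictly increasing and nonnegative on $[1,\infty)$ with $f(t)/\ln t\to0$, such that for each $k$ the set $\{s\ge 1: f(s)\ge\epsilon_c^k\}$ is nonempty; let $t_k^\dagger$ be its infimum (so $t_k^\dagger=f^{-1}(\epsilon_c^k)$ if $\epsilon_c^k\in f([1,\infty))$). The estimates start from $\hat n_i(0)=\hat s_i(0)=0\in\mathbb R^M$ and follow $\hat n_i(t)=P(\hat n_i(t-1)+\xi_i(t))$, $\hat s_i(t)=P(\hat s_i(t-1)+\rho_i(t))$, where $\xi_i^k(t)=\mathbf 1\{i^k(t)=i\}$ and $\rho_i^k(t)=r_i^k(t)\xi_i^k(t)$. For $t\le N$ agent $k$ chooses the arm congruent to $t-1+k$ modulo $N$. For $t>N$ put $$C_i^k=\sigma_g\sqrt{\frac{2\gamma}{G(\eta)}\cdot\frac{\hat n_i^k+f(t-1)}{M\hat n_i^k}\cdot\frac{\ln(t-1)}{\hat n_i^k}},\qquad Q_i^k=\frac{\hat s_i^k}{\hat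 n_i^k}+C_i^k,\qquad W_i^k=\frac{\hat s_i^k}{\hat n_i^k}-C_i^k,$$ with $\hat n_i^k,\hat s_i^k$ taken at time $t-1$, and $Q_i^k=+\infty$, $W_i^k=-\infty$ if $\hat n_i^k=0$. Agent $k$ takes a set of $k$ arms with the $k$ highest values of $Q_i^k$ and chooses in it an arm with the lowest $W_i^k$; ties are broken by any rule that depends only on the past. Claim. For every $T\ge1$, $$R^{\mathrm{con}}(T)\le\sum_{k=1}^MR^k(T)\le m_{i^*}NB+\sum_{k=1}^Mm_{b^k}B,$$ where $$B=\frac{4\sigma_g^2\gamma}{\Delta_{\min}^2G(\eta)}\left(1+\sqrt{1+\frac{\Delta_{\min}^2MG(\eta)}{2\sigma_g^2\gamma}\cdot\frac{f(T)}{\ln T}}\right)\ln T+\bar L$$ (the first summand is read as its limit $0$ if $T=1$) and $$\bar L=\sum_{k=1}^M(t_k^\dagger-1)+M(1+\epsilon_n)+1+\frac{2M(N+1)}{\ln(1+\eta)}\left(\frac1{(\gamma-1)^2}+\frac{\gamma\ln\big((1+\epsilon_n)(1+\eta)\big)}{\gamma-1}+1\right).$$ -/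

import Mathlib

open MeasureTheory ProbabilityTheory

namespace CoopBandit

noncomputable section

/-! ### Communication graph, consensus matrix and graph indices -/

/-- The consensus matrix `P = I - (κ / d_max) L`, with `L` the graph Laplacian.
(For a single agent `L = 0`, so `P = I` whatever `κ / d_max` means.) -/
def consensusMatrix {M : ℕ} (G : SimpleGraph (Fin M)) [DecidableRel G.Adj] (κ : ℝ) :
    Matrix (Fin M) (Fin M) ℝ :=
  1 - (κ / (G.maxDegree : ℝ)) • G.lapMatrix ℝ

/-- `u 0, u 1, …` is an orthonormal basis of eigenvectors of `P`, with eigenvalues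
`lam 0 ≥ lam 1 ≥ …`.  (The index `p` here is `p + 1` in one-based notation.) -/
structure IsEigenbasis {M : ℕ} (P : Matrix (Fin M) (Fin M) ℝ)
    (lam : Fin M → ℝ) (u : Fin M → Fin M → ℝ) : Prop where
  orthonormal : ∀ p q, u p ⬝ᵥ u q = if p = q then 1 else 0
  eigen : ∀ p, P.mulVec (u p) = lam p • u p
  antitone : Antitone lam

/-- The sum of the nonnegative terms of `∑ d, u_p^d u_j^d`. -/
def nuPlus {M : ℕ} (u : Fin M → Fin M → ℝ) (p j : Fin M) : ℝ :=
  ∑ d, if 0 ≤ u p d * u j d then u p d * u j d else 0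

/-- The sum of the nonpositive terms of `∑ d, u_p^d u_j^d`. -/
def nuMinus {M : ℕ} (u : Fin M → Fin M → ℝ) (p j : Fin M) : ℝ :=
  ∑ d, if u p d * u j d ≤ 0 then u p d * u j d else 0

/-- The coefficient `a_{pj}(k)`. -/
def aCoef {M : ℕ} (lam : Fin M → ℝ) (u : Fin M → Fin M → ℝ) (p j k : Fin M) : ℝ :=
  if lam p * lam j < 0 then max |nuMinus u p j| (nuPlus u p j) * |u p k * u j k|
  else if 0 ≤ u p k * u j k then nuPlus u p j * (u p k * u j k)
  else nuMinus u p j * (u p k * u j k)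

/-- The graph explore-exploit index `ε_n`; the sum leaves out the leading eigenvalue. -/
def epsN {M : ℕ} (lam : Fin M → ℝ) : ℝ :=
  √(M : ℝ) * ∑ p ∈ Finset.univ.filter (fun p : Fin M => (p : ℕ) ≠ 0), |lam p| / (1 - |lam p|)

/-- The nodal explore-exploit centrality index `ε_c^k`. -/
def epsC {M : ℕ} (lam : Fin M → ℝ) (u : Fin M → Fin M → ℝ) (k : Fin M) : ℝ :=
  (M : ℝ) * ∑ p : Fin M, ∑ j ∈ Finset.univ.filter (fun j : Fin M => (j : ℕ) ≠ 0),
    |lam p * lam j| / (1 - |lam p * lam j|) * aCoef lam u p j k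

/-! ### Cooperative estimation

Rounds are numbered from `0`: round `n` is time `t = n + 1`, so that the state available to the
agents when they choose in round `n` is the state at time `t - 1 = n`.  Agents and arms are numbered
from `0` as well. -/

/-- `nHat P sel i n k` is `n̂_i^k(n)`: `n̂_i(0) = 0`, `n̂_i(t) = P (n̂_i(t-1) + ξ_i(t))`. -/
def nHat {N M : ℕ} (P : Matrix (Fin M) (Fin M) ℝ) (sel : ℕ → Fin M → Fin N) (i : Fin N) :
    ℕ → Fin M → ℝ
  | 0 => 0
  | n + 1 => P.mulVec (nHat P sel i n + fun k => if sel n k = i then 1 else 0)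

/-- `sHat P r sel i n k` is `ŝ_i^k(n)`: `ŝ_i(0) = 0`, `ŝ_i(t) = P (ŝ_i(t-1) + r_i(t))`, where only
the rewards of the agents that select arm `i` enter. -/
def sHat {N M : ℕ} (P : Matrix (Fin M) (Fin M) ℝ) (r : ℕ → Fin N → Fin M → ℝ)
    (sel : ℕ → Fin M → Fin N) (i : Fin N) : ℕ → Fin M → ℝ
  | 0 => 0
  | n + 1 => P.mulVec (sHat P r sel i n + fun k => r n i k * if sel n k = i then 1 else 0)

/-- `G(η) = 1 - η² / 16`. -/
def gEta (η : ℝ) : ℝ := 1 - η ^ 2 / 16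

/-! ### The algorithm -/

/-- The confidence width `C_i^k(n)` as a function of `x = n̂_i^k(n)`. -/
def confWidth (M : ℕ) (σ γ η : ℝ) (f : ℝ → ℝ) (n : ℕ) (x : ℝ) : ℝ :=
  σ * √(2 * γ / gEta η * ((x + f n) / (M * x)) * (Real.log n / x))

/-- The upper index `Q_i^k(n) = ŝ / n̂ + C`, and `+∞` where the agent has no information yet on
the arm (`n̂ = 0`). -/
def upperIndex {N M : ℕ} (P : Matrix (Fin M) (Fin M) ℝ) (σ γ η : ℝ) (f : ℝ → ℝ)
    (r : ℕ → Fin N → Fin M → ℝ) (sel : ℕ → Fin M → Fin N) (n : ℕ) (k : Fin M) (i : Fin N) :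
    EReal :=
  if nHat P sel i n k = 0 then ⊤
  else ((sHat P r sel i n k / nHat P sel i n k
    + confWidth M σ γ η f n (nHat P sel i n k) : ℝ) : EReal)

/-- The lower index `W_i^k(n) = ŝ / n̂ - C`, and `-∞` where `n̂ = 0`. -/
def lowerIndex {N M : ℕ} (P : Matrix (Fin M) (Fin M) ℝ) (σ γ η : ℝ) (f : ℝ → ℝ)
    (r : ℕ → Fin N → Fin M → ℝ) (sel : ℕ → Fin M → Fin N) (n : ℕ) (k : Fin M) (i : Fin N) :
    EReal :=
  if nHat P sel i n k = 0 then ⊥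
  else ((sHat P r sel i n k / nHat P sel i n k
    - confWidth M σ γ η f n (nHat P sel i n k) : ℝ) : EReal)

/-- `a` minimizes `W` on a set `O` of `c` arms that have the `c` highest values of `Q`
(ties may be broken in any way). -/
def IsSelectiveChoice {N : ℕ} (c : ℕ) (Q W : Fin N → EReal) (a : Fin N) : Prop :=
  ∃ O : Finset (Fin N), O.card = c ∧ (∀ i ∈ O, ∀ j ∉ O, Q j ≤ Q i) ∧
    a ∈ O ∧ ∀ i ∈ O, W a ≤ W i

/-- The selections `sel n k` follow coop-UCB2-selective-learning along the reward path `r`: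
round-robin for `N` rounds, agent `k` starting with the `k`-th arm; then agent `k` (whose one-based
rank is `k + 1`) picks the arm with the lowest `W` among `k + 1` arms with the highest `Q`. -/
structure IsSelectiveLearningRun {N M : ℕ} (P : Matrix (Fin M) (Fin M) ℝ) (σ γ η : ℝ)
    (f : ℝ → ℝ) (r : ℕ → Fin N → Fin M → ℝ) (sel : ℕ → Fin M → Fin N) : Prop where
  init : ∀ n < N, ∀ k : Fin M, (sel n k : ℕ) = (n + k) % N
  select : ∀ n, N ≤ n → ∀ k : Fin M, IsSelectiveChoice ((k : ℕ) + 1)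
    (upperIndex P σ γ η f r sel n k) (lowerIndex P σ γ η f r sel n k) (sel n k)

/-! ### Rewards -/

/-- The probability distribution `p` on `ℝ` is sub-Gaussian with parameter `σ`: its cumulant
generating function is finite and at most `m β + σ² β² / 2`, where `m` is the mean of `p`. -/
def IsSubGaussianLaw (p : Measure ℝ) (σ : ℝ) : Prop :=
  ∀ β : ℝ, Integrable (fun x => Real.exp (β * x)) p ∧
    cgf id p β ≤ (∫ x, x ∂p) * β + σ ^ 2 * β ^ 2 / 2

/-- The sigma-algebra of the rewards before round `n`. -/
abbrev pastRewards {Ω : Type*} {N M : ℕ} (r : ℕ → Fin N → Fin M → Ω → ℝ) (n : ℕ) :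
    MeasurableSpace Ω :=
  ⨆ (s : ℕ) (_ : s < n) (i : Fin N) (k : Fin M),
    MeasurableSpace.comap (r s i k) inferInstance

/-- The choices in each round are determined by the rewards of the earlier rounds (ties included). -/
def DependsOnPast {Ω : Type*} {N M : ℕ} (r : ℕ → Fin N → Fin M → Ω → ℝ)
    (sel : ℕ → Fin M → Ω → Fin N) : Prop :=
  ∀ n k, Measurable[pastRewards r n] (sel n k)

/-! ### Regret in the constrained model -/

/-- The indicator that agent `k` is the only agent to select arm `i` in round `n`. -/
def soleInd {N M : ℕ} (sel : ℕ → Fin M → Fin N) (n : ℕ) (k : Fin M) (i : Fin N) : ℝ :=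
  if sel n k = i ∧ ∀ j, j ≠ k → sel n j ≠ i then 1 else 0

/-- The expected cumulative group regret in the constrained model, where `best k` is the `k`-th
best arm. -/
def groupRegret {Ω : Type*} [MeasurableSpace Ω] {N M : ℕ} (μ : Measure Ω) (m : Fin N → ℝ)
    (best : Fin M → Fin N) (sel : ℕ → Fin M → Ω → Fin N) (T : ℕ) : ℝ :=
  T * ∑ k, m (best k) -
    ∫ ω, ∑ n ∈ Finset.range T, ∑ k,
      m (sel n k ω) * soleInd (fun n k => sel n k ω) n k (sel n k ω) ∂μ

/-- The expected cumulative regret `R^k(T)` of agent `k`. -/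
def agentRegret {Ω : Type*} [MeasurableSpace Ω] {N M : ℕ} (μ : Measure Ω) (m : Fin N → ℝ)
    (best : Fin M → Fin N) (r : ℕ → Fin N → Fin M → Ω → ℝ) (sel : ℕ → Fin M → Ω → Fin N)
    (T : ℕ) (k : Fin M) : ℝ :=
  ∑ n ∈ Finset.range T, (m (best k) -
    ∫ ω, ∑ i, r n i k ω * (if sel n k ω = i then 1 else 0) *
      soleInd (fun n k => sel n k ω) n k i ∂μ)

/-! ### The bound -/

/-- `Δ_min`, the least distance between the means of two different arms. -/
def minGap {N : ℕ} (m : Fin N → ℝ) : ℝ :=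
  ⨅ q : {q : Fin N × Fin N // q.1 ≠ q.2}, |m q.1.1 - m q.1.2|

/-- The inverse of the increasing function `f` on the time axis `[1, ∞)`. -/
def timeInv (f : ℝ → ℝ) (y : ℝ) : ℝ := sInf {s : ℝ | 1 ≤ s ∧ y ≤ f s}

theorem timeInv_eq {f : ℝ → ℝ} (hf : StrictMonoOn f (Set.Ici 1)) {s : ℝ} (hs : 1 ≤ s) :
    timeInv f (f s) = s := by
  have h : {x : ℝ | 1 ≤ x ∧ f s ≤ f x} = Set.Ici s := by
    ext x
    constructor
    · rintro ⟨hx, h⟩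
      exact (hf.le_iff_le hs hx).1 h
    · intro hx
      have hx' : s ≤ x := hx
      exact ⟨hs.trans hx', (hf.le_iff_le hs (hs.trans hx')).2 hx'⟩
  rw [timeInv, h, csInf_Ici]

/-- The part `L̄` of the bound that does not depend on `T`; `tdag k` is `f⁻¹(ε_c^k)`. -/
def lBar (N M : ℕ) (γ η εn : ℝ) (tdag : Fin M → ℝ) : ℝ :=
  ∑ k, (tdag k - 1) + M * (1 + εn) + 1 +
    2 * M * (N + 1) / Real.log (1 + η) *
      (1 / (γ - 1) ^ 2 + γ * Real.log ((1 + εn) * (1 + η)) / (γ - 1) + 1)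

/-- The bound `B` on the number of incorrect selections, with `Δ = Δ_min`. -/
def boundB (N M : ℕ) (σ γ η : ℝ) (f : ℝ → ℝ) (Δ εn : ℝ) (tdag : Fin M → ℝ) (T : ℕ) : ℝ :=
  4 * σ ^ 2 * γ / (Δ ^ 2 * gEta η) *
      (1 + √(1 + Δ ^ 2 * M * gEta η / (2 * σ ^ 2 * γ) * (f T / Real.log T))) * Real.log T +
    lBar N M γ η εn tdag

end

end CoopBandit

/-! Regret is paid for by wrong selections. If agent `k` plays an arm other than its target, the
loss is at most the largest mean and is charged to the arm played. If it plays its target and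
collides, some other agent is there wrongly, and the loss `m (best k)` is charged to that arm
(`round_loss_le`). Rewards of a round are independent of the selections of that round, so realized
rewards may be replaced by means, and the sum of the agent regrets equals the group regret
(`integral_reward_eq`). It remains to show that each arm has at most `B` expected wrong selections.

Fix an arm and let `x` be an agent's estimate `nHat`. Apart from an error `epsN`, `x` is the total
number of selections of the arm divided by `M` (`average_le`). Hence, after about `A + M * epsN`
selections, with `A` the logarithmic term of `boundB`, the confidence width is at most half the
minimal gap (`confWidth_le`). From then on a wrong selection forces one of `N + 1` estimates outside
its confidence interval (`IsSelectiveChoice.exists_deviation`). The rounds in which `f n < epsC` are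
counted separately.

The deviation probability comes from a self-normalized Chernoff bound with peeling. For a fixed
round, the estimate is a weighted sum of rewards with weights taken from powers of `P`, and its
exponential with quadratic compensator `V` has mean at most one (`lintegral_exp_weighted_le`). The
spectral expansion of `P ^ s` gives `V ≤ Y = (x + f n) / M` once `epsC ≤ f n` (`sum_sq_le`); this is
the reason for the shape of the width. The round-robin start gives `x ≥ 3/4 - epsC` (`weighted_ge`),
so `Y` stays between `a` and `a * n ^ 2` for a deterministic `a`. Logarithmically many cells of
ratio `1 + η` cover this range, each costing `n ^ (-γ)` (`measure_peel_le`), and the sum over rounds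
converges because `γ > 1`. -/

namespace CoopBandit

/-! ### Spectral facts about the consensus matrix -/

section Spectral

variable {M : ℕ} {P : Matrix (Fin M) (Fin M) ℝ} {lam : Fin M → ℝ} {u : Fin M → Fin M → ℝ}

/-- A one-sided inverse of a square matrix is two-sided, so orthonormal rows give orthonormal
columns. -/
theorem IsEigenbasis.complete (h : IsEigenbasis P lam u) (k j : Fin M) :
    ∑ p, u p k * u p j = if k = j then 1 else 0 := by
  have h1 : Matrix.of u * (Matrix.of u).transpose = 1 := by
    ext p q
    rw [Matrix.mul_apply, Matrix.one_apply, ← h.orthonormal p q]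
    rfl
  have h2 : ((Matrix.of u).transpose * Matrix.of u) k j = (1 : Matrix (Fin M) (Fin M) ℝ) k j := by
    rw [mul_eq_one_comm.1 h1]
  rw [Matrix.mul_apply, Matrix.one_apply] at h2
  exact h2

theorem IsEigenbasis.pow_mulVec (h : IsEigenbasis P lam u) (s : ℕ) (p : Fin M) :
    (P ^ s).mulVec (u p) = lam p ^ s • u p := by
  induction s with
  | zero => simp
  | succ s ih =>
    rw [pow_succ, ← Matrix.mulVec_mulVec, h.eigen, Matrix.mulVec_smul, ih, smul_smul, pow_succ,
      mul_comm]

theorem IsEigenbasis.pow_apply (h : IsEigenbasis P lam u) (s : ℕ) (k j : Fin M) :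
    (P ^ s) k j = ∑ p, lam p ^ s * (u p k * u p j) := by
  have h1 : (fun i => if i = j then (1 : ℝ) else 0) = ∑ p, u p j • u p := by
    ext i
    rw [← h.complete i j]
    simp [mul_comm]
  have h2 : (P ^ s) k j = (P ^ s).mulVec (fun i => if i = j then (1 : ℝ) else 0) k := by
    simp [Matrix.mulVec, dotProduct]
  rw [h2, h1, Matrix.mulVec_sum, Finset.sum_apply]
  refine Finset.sum_congr rfl fun p _ => ?_
  rw [Matrix.mulVec_smul, h.pow_mulVec]
  simp only [Pi.smul_apply, smul_eq_mul]
  ring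

variable (G : SimpleGraph (Fin M)) [DecidableRel G.Adj] {κ : ℝ}

/-- The diagonal entry is `1 - κ * degree / maxDegree`, which is nonnegative because `κ ≤ 1`; off
the diagonal the Laplacian is nonpositive. -/
theorem consensusMatrix_nonneg (hκ0 : 0 < κ) (hκ1 : κ ≤ 1) (k j : Fin M) :
    0 ≤ consensusMatrix G κ k j := by
  have hc : 0 ≤ κ / (G.maxDegree : ℝ) := by positivity
  rw [consensusMatrix, Matrix.sub_apply, Matrix.smul_apply, SimpleGraph.lapMatrix,
    Matrix.sub_apply, SimpleGraph.degMatrix, smul_eq_mul]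
  by_cases hkj : k = j
  · subst hkj
    have h1 : κ / (G.maxDegree : ℝ) * G.degree k ≤ 1 := by
      have hd : (G.degree k : ℝ) ≤ G.maxDegree := by exact_mod_cast G.degree_le_maxDegree k
      -- Without edges, `κ / 0 = 0` and the claim is trivial.
      rcases (Nat.cast_nonneg (α := ℝ) G.maxDegree).eq_or_lt with h0 | h0
      · rw [← h0]; simp
      · rw [div_mul_eq_mul_div, div_le_one h0]
        have : (0:ℝ) ≤ G.degree k := by positivity
        nlinarith
    simpa using h1
  · rw [Matrix.one_apply_ne hkj, Matrix.diagonal_apply_ne _ hkj, SimpleGraph.adjMatrix_apply]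
    split_ifs <;> simp [hc]

theorem consensusMatrix_mulVec_one : (consensusMatrix G κ).mulVec (fun _ => 1) = fun _ => 1 := by
  rw [consensusMatrix, Matrix.sub_mulVec, Matrix.smul_mulVec,
    SimpleGraph.lapMatrix_mulVec_const_eq_zero]
  simp

theorem consensusMatrix_pow_nonneg (hκ0 : 0 < κ) (hκ1 : κ ≤ 1) (s : ℕ) (k j : Fin M) :
    0 ≤ (consensusMatrix G κ ^ s) k j := by
  induction s generalizing k j with
  | zero => rw [pow_zero, Matrix.one_apply]; split_ifs <;> simp
  | succ s ih =>
    rw [pow_succ, Matrix.mul_apply]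
    exact Finset.sum_nonneg fun i _ => mul_nonneg (ih k i) (consensusMatrix_nonneg G hκ0 hκ1 i j)

theorem consensusMatrix_pow_row_sum (s : ℕ) (k : Fin M) :
    ∑ j, (consensusMatrix G κ ^ s) k j = 1 := by
  have h : (consensusMatrix G κ ^ s).mulVec (fun _ => 1) = fun _ => 1 := by
    induction s with
    | zero => simp
    | succ s ih => rw [pow_succ, ← Matrix.mulVec_mulVec, consensusMatrix_mulVec_one, ih]
  simpa [Matrix.mulVec, dotProduct] using congrFun h k

variable {G}

/-- An eigenvector of the consensus matrix has eigenvalue at most `1`, with equality only for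
constant vectors. -/
theorem IsEigenbasis.lam_le_one (h : IsEigenbasis (consensusMatrix G κ) lam u) (hG : G.Connected)
    (hκ0 : 0 < κ) (p : Fin M) : lam p ≤ 1 ∧ (lam p = 1 → ∀ i j, u p i = u p j) := by
  have hquad : lam p = 1 - κ / (G.maxDegree : ℝ) *
      Matrix.toLinearMap₂' ℝ (G.lapMatrix ℝ) (u p) (u p) := by
    have h1 : u p ⬝ᵥ (consensusMatrix G κ).mulVec (u p) = lam p := by
      rw [h.eigen, dotProduct_smul, h.orthonormal]; simp
    rw [← h1, consensusMatrix, Matrix.sub_mulVec, Matrix.smul_mulVec, dotProduct_sub,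
      Matrix.one_mulVec, h.orthonormal, dotProduct_smul, Matrix.toLinearMap₂'_apply']
    simp
  have hnn : 0 ≤ Matrix.toLinearMap₂' ℝ (G.lapMatrix ℝ) (u p) (u p) := by
    rw [SimpleGraph.lapMatrix_toLinearMap₂']; positivity
  have hc : 0 ≤ κ / (G.maxDegree : ℝ) := by positivity
  refine ⟨by rw [hquad]; linarith [mul_nonneg hc hnn], fun h1 i j => ?_⟩
  by_cases hij : i = j
  · rw [hij]
  have hd : 0 < G.maxDegree := by
    have : Nontrivial (Fin M) := ⟨i, j, hij⟩
    exact (hG.preconnected.degree_pos_of_nontrivial i).trans_le (G.degree_le_maxDegree i)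
  have hc' : 0 < κ / (G.maxDegree : ℝ) := by positivity
  have h0 : Matrix.toLinearMap₂' ℝ (G.lapMatrix ℝ) (u p) (u p) = 0 := by
    rw [h1] at hquad
    have : κ / (G.maxDegree : ℝ) * Matrix.toLinearMap₂' ℝ (G.lapMatrix ℝ) (u p) (u p) = 0 := by
      linarith
    exact (mul_eq_zero.1 this).resolve_left hc'.ne'
  exact (G.lapMatrix_toLinearMap₂'_apply'_eq_zero_iff_forall_reachable (u p)).1 h0 i j
    (hG.preconnected i j)

/-- A constant unit vector has all entries equal to one of `±1 / √M`; the products do not see the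
sign. -/
theorem IsEigenbasis.mul_of_const (h : IsEigenbasis P lam u) {p : Fin M}
    (hp : ∀ i j, u p i = u p j) (k j : Fin M) : u p k * u p j = 1 / M := by
  have hM : (0 : ℝ) < M := by exact_mod_cast k.pos
  have h1 := h.orthonormal p p
  rw [if_pos rfl, dotProduct, Finset.sum_congr rfl fun i _ => by rw [hp i k]] at h1
  simp only [Finset.sum_const, Finset.card_univ, Fintype.card_fin, nsmul_eq_mul] at h1
  rw [hp j k]
  field_simp
  linarith

/-- If `1` were not among the listed eigenvalues, symmetry of the matrix would make every
eigenvector orthogonal to the constants, against completeness. Two indices with eigenvalue `1` would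
give two constant unit vectors, which cannot be orthogonal; connectedness enters through
`lam_le_one`. -/
theorem IsEigenbasis.leading (h : IsEigenbasis (consensusMatrix G κ) lam u) (hG : G.Connected)
    (hκ0 : 0 < κ) {z : Fin M} (hz : (z : ℕ) = 0) :
    lam z = 1 ∧ (∀ k j, u z k * u z j = 1 / M) ∧ ∀ p, p ≠ z → lam p < 1 := by
  have hM : (0 : ℝ) < M := by exact_mod_cast z.pos
  have hex : ∃ p, lam p = 1 := by
    by_contra! hne
    have h0 : ∀ p, u p ⬝ᵥ (fun _ => (1 : ℝ)) = 0 := by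
      intro p
      have hsym : (consensusMatrix G κ).IsSymm := by
        rw [consensusMatrix]
        exact (Matrix.isSymm_one).sub ((G.isSymm_lapMatrix (R := ℝ)).smul _)
      have h1 : u p ⬝ᵥ (consensusMatrix G κ).mulVec (fun _ => (1 : ℝ))
          = lam p * (u p ⬝ᵥ fun _ => (1 : ℝ)) := by
        rw [Matrix.dotProduct_mulVec, ← Matrix.mulVec_transpose, hsym.eq, h.eigen, smul_dotProduct,
          smul_eq_mul]
      rw [consensusMatrix_mulVec_one] at h1
      have h2 : (1 - lam p) * (u p ⬝ᵥ fun _ => (1 : ℝ)) = 0 := by linarith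
      exact (mul_eq_zero.1 h2).resolve_left (sub_ne_zero.2 (hne p).symm)
    have h1 : ∑ j, ∑ p, u p z * u p j = (1 : ℝ) := by
      simp [h.complete]
    rw [Finset.sum_comm] at h1
    have h2 : ∀ p, ∑ j, u p z * u p j = 0 := by
      intro p
      have := h0 p
      simp only [dotProduct, mul_one] at this
      rw [← Finset.mul_sum, this, mul_zero]
    simp [h2] at h1
  obtain ⟨p, hp⟩ := hex
  have hz1 : lam z = 1 :=
    le_antisymm (h.lam_le_one hG hκ0 z).1 (hp ▸ h.antitone (Fin.le_def.2 (by omega)))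
  have hzc := (h.lam_le_one hG hκ0 z).2 hz1
  have hzm := h.mul_of_const hzc
  refine ⟨hz1, hzm, fun q hq => lt_of_le_of_ne (h.lam_le_one hG hκ0 q).1 fun hq1 => ?_⟩
  have hqc := (h.lam_le_one hG hκ0 q).2 hq1
  have hqm := h.mul_of_const hqc
  have ho := h.orthonormal z q
  rw [if_neg (Ne.symm hq), dotProduct,
    Finset.sum_congr rfl fun i _ => by rw [hzc i z, hqc i z]] at ho
  simp only [Finset.sum_const, Finset.card_univ, Fintype.card_fin, nsmul_eq_mul] at ho
  have h3 := hzm z z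
  have h4 := hqm z z
  have h5 : u z z * u q z = 0 := (mul_eq_zero.1 ho).resolve_left hM.ne'
  have h6 : (u z z * u z z) * (u q z * u q z) = 0 := by
    linear_combination (u z z * u q z) * h5
  rw [h3, h4] at h6
  have : (0:ℝ) < 1 / M * (1 / M) := by positivity
  linarith

/-- The properties of the powers of the consensus matrix that the estimates rest on; `z` is the
index of the leading eigenvalue. -/
structure IsStochasticSpectrum (P : Matrix (Fin M) (Fin M) ℝ) (lam : Fin M → ℝ)
    (u : Fin M → Fin M → ℝ) (z : Fin M) : Prop where
  basis : IsEigenbasis P lam u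
  pow_nonneg : ∀ s k j, 0 ≤ (P ^ s) k j
  row_sum : ∀ s k, ∑ j, (P ^ s) k j = 1
  index_zero : (z : ℕ) = 0
  lam_zero : lam z = 1
  u_zero : ∀ k j, u z k * u z j = 1 / M
  abs_lt : ∀ p, p ≠ z → |lam p| < 1

theorem IsEigenbasis.isStochasticSpectrum (h : IsEigenbasis (consensusMatrix G κ) lam u)
    (hG : G.Connected) (hκ0 : 0 < κ) (hκ1 : κ ≤ 1) (hlam : ∀ p, -1 < lam p) {z : Fin M}
    (hz : (z : ℕ) = 0) : IsStochasticSpectrum (consensusMatrix G κ) lam u z where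
  basis := h
  pow_nonneg := consensusMatrix_pow_nonneg G hκ0 hκ1
  row_sum := consensusMatrix_pow_row_sum G
  index_zero := hz
  lam_zero := (h.leading hG hκ0 hz).1
  u_zero := (h.leading hG hκ0 hz).2.1
  abs_lt p hp := abs_lt.2 ⟨hlam p, (h.leading hG hκ0 hz).2.2 p hp⟩

end Spectral

/-! ### Deterministic bounds on the cooperative estimates -/

section Estimates

/-- `P` acts after the new term is added, so a contribution of round `τ` has been averaged `n - τ ≥
1` times. This is why the geometric sums below start with exponent one. -/
theorem consensus_recursion {M : ℕ} {P : Matrix (Fin M) (Fin M) ℝ} {x y : ℕ → Fin M → ℝ}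
    (h0 : x 0 = 0) (hs : ∀ n, x (n + 1) = P.mulVec (x n + y n)) (n : ℕ) (k : Fin M) :
    x n k = ∑ τ ∈ Finset.range n, ∑ j, (P ^ (n - τ)) k j * y τ j := by
  have h : ∀ n, x n = ∑ τ ∈ Finset.range n, (P ^ (n - τ)).mulVec (y τ) := by
    intro n
    induction n with
    | zero => simp [h0]
    | succ n ih =>
      rw [hs, Matrix.mulVec_add, ih, Matrix.mulVec_sum, Finset.sum_range_succ]
      congr 1
      · refine Finset.sum_congr rfl fun τ hτ => ?_
        rw [Matrix.mulVec_mulVec, ← pow_succ', Nat.sub_add_comm (Finset.mem_range.1 hτ).le]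
      · simp
  rw [h n, Finset.sum_apply]
  rfl

theorem nHat_eq {N M : ℕ} (P : Matrix (Fin M) (Fin M) ℝ) (sel : ℕ → Fin M → Fin N) (i : Fin N)
    (n : ℕ) (k : Fin M) :
    nHat P sel i n k =
      ∑ τ ∈ Finset.range n, ∑ j, (P ^ (n - τ)) k j * (if sel τ j = i then 1 else 0) :=
  consensus_recursion (x := nHat P sel i) (y := fun τ j => if sel τ j = i then 1 else 0)
    rfl (fun _ => rfl) n k

theorem sHat_eq {N M : ℕ} (P : Matrix (Fin M) (Fin M) ℝ) (r : ℕ → Fin N → Fin M → ℝ)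
    (sel : ℕ → Fin M → Fin N) (i : Fin N) (n : ℕ) (k : Fin M) :
    sHat P r sel i n k = ∑ τ ∈ Finset.range n, ∑ j,
      (P ^ (n - τ)) k j * (r τ i j * if sel τ j = i then 1 else 0) :=
  consensus_recursion (x := sHat P r sel i) (y := fun τ j => r τ i j * if sel τ j = i then 1 else 0)
    rfl (fun _ => rfl) n k

theorem sum_geom_le {q : ℝ} (h0 : 0 ≤ q) (h1 : q < 1) (n : ℕ) :
    ∑ τ ∈ Finset.range n, q ^ (n - τ) ≤ q / (1 - q) := by
  have h1' : 0 < 1 - q := by linarith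
  induction n with
  | zero => simpa using div_nonneg h0 h1'.le
  | succ n ih =>
    have h2 : ∑ τ ∈ Finset.range (n + 1), q ^ (n + 1 - τ)
        = q * (∑ τ ∈ Finset.range n, q ^ (n - τ) + 1) := by
      rw [Finset.sum_range_succ, mul_add, Finset.mul_sum]
      congr 1
      · refine Finset.sum_congr rfl fun τ hτ => ?_
        rw [← pow_succ', Nat.sub_add_comm (Finset.mem_range.1 hτ).le]
      · simp
    rw [h2]
    calc q * (∑ τ ∈ Finset.range n, q ^ (n - τ) + 1) ≤ q * (q / (1 - q) + 1) := by gcongr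
      _ = q / (1 - q) := by field_simp; ring

variable {M : ℕ} {P : Matrix (Fin M) (Fin M) ℝ} {lam : Fin M → ℝ} {u : Fin M → Fin M → ℝ}
  {z : Fin M}

theorem filter_ne_zero_eq (hz : (z : ℕ) = 0) :
    Finset.univ.filter (fun p : Fin M => (p : ℕ) ≠ 0) = Finset.univ.erase z := by
  ext p
  simp only [Finset.mem_filter, Finset.mem_univ, true_and, Finset.mem_erase, and_true, ne_eq,
    Fin.ext_iff, hz]

theorem IsEigenbasis.sum_sq (h : IsEigenbasis P lam u) (p : Fin M) : ∑ j, u p j ^ 2 = 1 := by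
  have := h.orthonormal p p
  simpa [dotProduct, sq] using this

theorem IsEigenbasis.abs_le_one (h : IsEigenbasis P lam u) (p k : Fin M) : |u p k| ≤ 1 := by
  rw [← sq_le_one_iff_abs_le_one, ← h.sum_sq p]
  exact Finset.single_le_sum (f := fun j => u p j ^ 2) (fun j _ => sq_nonneg _) (Finset.mem_univ k)

namespace IsStochasticSpectrum

theorem abs_le (h : IsStochasticSpectrum P lam u z) (p : Fin M) : |lam p| ≤ 1 := by
  by_cases hp : p = z
  · rw [hp, h.lam_zero, abs_one]
  · exact (h.abs_lt p hp).le

theorem abs_mul_lt (h : IsStochasticSpectrum P lam u z) (p : Fin M) {j : Fin M} (hj : j ≠ z) :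
    |lam p * lam j| < 1 := by
  rw [abs_mul]
  calc |lam p| * |lam j| ≤ 1 * |lam j| := by gcongr; exact h.abs_le p
    _ < 1 := by rw [one_mul]; exact h.abs_lt j hj

theorem pow_apply (h : IsStochasticSpectrum P lam u z) (s : ℕ) (k j : Fin M) :
    (P ^ s) k j = 1 / M + ∑ p ∈ Finset.univ.erase z, lam p ^ s * (u p k * u p j) := by
  rw [h.basis.pow_apply, ← Finset.add_sum_erase _ _ (Finset.mem_univ z), h.lam_zero, h.u_zero,
    one_pow, one_mul]

/-- The weighted count is at most the number of rounds. -/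
theorem weighted_le (h : IsStochasticSpectrum P lam u z) {ξ : ℕ → Fin M → ℝ}
    (hξ1 : ∀ τ j, ξ τ j ≤ 1) (n : ℕ) (k : Fin M) :
    ∑ τ ∈ Finset.range n, ∑ j, (P ^ (n - τ)) k j * ξ τ j ≤ n := by
  calc ∑ τ ∈ Finset.range n, ∑ j, (P ^ (n - τ)) k j * ξ τ j
      ≤ ∑ τ ∈ Finset.range n, ∑ j, (P ^ (n - τ)) k j := by
        gcongr with τ _ j _
        exact mul_le_of_le_one_right (h.pow_nonneg _ _ _) (hξ1 τ j)
    _ = n := by simp [h.row_sum]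

/-- The weighted count is close to the average of the individual counts. -/
theorem average_le (h : IsStochasticSpectrum P lam u z) {ξ : ℕ → Fin M → ℝ}
    (hξ0 : ∀ τ j, 0 ≤ ξ τ j) (hξ1 : ∀ τ j, ξ τ j ≤ 1) (n : ℕ) (k : Fin M) :
    ∑ τ ∈ Finset.range n, ∑ j, ξ τ j ≤
      M * (∑ τ ∈ Finset.range n, ∑ j, (P ^ (n - τ)) k j * ξ τ j + epsN lam) := by
  have hM : (0 : ℝ) < M := by exact_mod_cast k.pos
  have h1 : ∑ τ ∈ Finset.range n, ∑ j, (P ^ (n - τ)) k j * ξ τ j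
      = 1 / M * ∑ τ ∈ Finset.range n, ∑ j, ξ τ j + ∑ p ∈ Finset.univ.erase z,
        ∑ τ ∈ Finset.range n, lam p ^ (n - τ) * (u p k * ∑ j, u p j * ξ τ j) := by
    rw [Finset.sum_comm (s := Finset.univ.erase z), Finset.mul_sum, ← Finset.sum_add_distrib]
    refine Finset.sum_congr rfl fun τ _ => ?_
    simp only [h.pow_apply, add_mul, Finset.sum_add_distrib, Finset.mul_sum, Finset.sum_mul]
    congr 1
    rw [Finset.sum_comm]
    refine Finset.sum_congr rfl fun p _ => Finset.sum_congr rfl fun j _ => by ring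
  -- By Cauchy–Schwarz each round contributes at most `√M` times the power of the eigenvalue; this
  -- gives the factor `√M` in `epsN`.
  have h2 : ∀ p ∈ Finset.univ.erase z,
      -(√(M : ℝ) * (|lam p| / (1 - |lam p|))) ≤
        ∑ τ ∈ Finset.range n, lam p ^ (n - τ) * (u p k * ∑ j, u p j * ξ τ j) := by
    intro p hp
    refine neg_le_of_abs_le ((Finset.abs_sum_le_sum_abs _ _).trans ?_)
    calc ∑ τ ∈ Finset.range n, |lam p ^ (n - τ) * (u p k * ∑ j, u p j * ξ τ j)|
        ≤ ∑ τ ∈ Finset.range n, √(M : ℝ) * |lam p| ^ (n - τ) := by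
          gcongr with τ _
          rw [abs_mul, abs_mul, abs_pow, mul_comm]
          have h3 : |∑ j, u p j * ξ τ j| ≤ √(M : ℝ) := by
            refine Real.abs_le_sqrt ?_
            refine (Finset.sum_mul_sq_le_sq_mul_sq _ _ _).trans ?_
            rw [h.basis.sum_sq, one_mul]
            calc ∑ j, ξ τ j ^ 2 ≤ ∑ _j : Fin M, (1 : ℝ) := by
                  gcongr with j _
                  exact pow_le_one₀ (hξ0 τ j) (hξ1 τ j)
              _ = M := by simp
          gcongr
          calc |u p k| * |∑ j, u p j * ξ τ j| ≤ 1 * √(M : ℝ) := by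
                gcongr; exact h.basis.abs_le_one p k
            _ = _ := one_mul _
      _ ≤ _ := by
          rw [← Finset.mul_sum]
          gcongr
          exact sum_geom_le (abs_nonneg _) (h.abs_lt p (Finset.ne_of_mem_erase hp)) n
  have h3 := Finset.sum_le_sum h2
  rw [Finset.sum_neg_distrib, ← Finset.mul_sum] at h3
  have h4 : epsN lam = √(M : ℝ) * ∑ p ∈ Finset.univ.erase z, |lam p| / (1 - |lam p|) := by
    rw [epsN, filter_ne_zero_eq h.index_zero]
  rw [← h4] at h3
  have h5 : ∑ τ ∈ Finset.range n, ∑ j, ξ τ j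
      = M * (1 / M * ∑ τ ∈ Finset.range n, ∑ j, ξ τ j) := by field_simp
  rw [h1, h5]
  gcongr
  rw [← h5]
  linarith

theorem nuPlus_nonneg (u : Fin M → Fin M → ℝ) (p j : Fin M) : 0 ≤ nuPlus u p j :=
  Finset.sum_nonneg fun d _ => by split_ifs with h <;> simp [h]

theorem nuMinus_nonpos (u : Fin M → Fin M → ℝ) (p j : Fin M) : nuMinus u p j ≤ 0 :=
  Finset.sum_nonpos fun d _ => by split_ifs with h <;> simp [h]

theorem aCoef_nonneg (lam : Fin M → ℝ) (u : Fin M → Fin M → ℝ) (p j k : Fin M) :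
    0 ≤ aCoef lam u p j k := by
  have h1 := nuPlus_nonneg u p j
  have h2 := nuMinus_nonpos u p j
  rw [aCoef]
  split_ifs with h3 h4
  · positivity
  · positivity
  · exact mul_nonneg_of_nonpos_of_nonpos h2 (not_le.1 h4).le

theorem sum_mul_le_nuPlus (u : Fin M → Fin M → ℝ) (p j : Fin M) {ξ : Fin M → ℝ}
    (hξ0 : ∀ d, 0 ≤ ξ d) (hξ1 : ∀ d, ξ d ≤ 1) : ∑ d, u p d * u j d * ξ d ≤ nuPlus u p j := by
  refine Finset.sum_le_sum fun d _ => ?_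
  split_ifs with h
  · exact mul_le_of_le_one_right h (hξ1 d)
  · exact mul_nonpos_of_nonpos_of_nonneg (not_le.1 h).le (hξ0 d)

theorem nuMinus_le_sum_mul (u : Fin M → Fin M → ℝ) (p j : Fin M) {ξ : Fin M → ℝ}
    (hξ0 : ∀ d, 0 ≤ ξ d) (hξ1 : ∀ d, ξ d ≤ 1) : nuMinus u p j ≤ ∑ d, u p d * u j d * ξ d := by
  refine Finset.sum_le_sum fun d _ => ?_
  split_ifs with h
  · nlinarith [hξ1 d]
  · exact mul_nonneg (not_le.1 h).le (hξ0 d)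

/-- This explains the three cases of `aCoef`. For a nonnegative product of eigenvalues the power
keeps its sign, and the sign of `u p k * u j k` decides which one-sided bound on the sum is needed.
For a negative product the sign alternates with `s`, so both sides must be controlled. -/
theorem pow_mul_le_aCoef (lam : Fin M → ℝ) (u : Fin M → Fin M → ℝ) (p j k : Fin M) {ξ : Fin M → ℝ}
    (hξ0 : ∀ d, 0 ≤ ξ d) (hξ1 : ∀ d, ξ d ≤ 1) (s : ℕ) :
    (lam p * lam j) ^ s * ((u p k * u j k) * ∑ d, u p d * u j d * ξ d)
      ≤ |lam p * lam j| ^ s * aCoef lam u p j k := by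
  have h1 := sum_mul_le_nuPlus u p j hξ0 hξ1
  have h2 := nuMinus_le_sum_mul u p j hξ0 hξ1
  rw [aCoef]
  split_ifs with h3 h4
  · refine (le_abs_self _).trans ?_
    rw [abs_mul, abs_pow, abs_mul (u p k * u j k), mul_comm (|u p k * u j k|)]
    have h5 : |∑ d, u p d * u j d * ξ d| ≤ max |nuMinus u p j| (nuPlus u p j) := by
      refine _root_.abs_le.2 ⟨?_, h1.trans (le_max_right _ _)⟩
      have := neg_abs_le (nuMinus u p j)
      have := le_max_left |nuMinus u p j| (nuPlus u p j)
      linarith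
    gcongr
  · rw [abs_of_nonneg (not_lt.1 h3), mul_comm (nuPlus u p j)]
    have := not_lt.1 h3
    gcongr
  · rw [abs_of_nonneg (not_lt.1 h3), mul_comm (nuMinus u p j)]
    have := not_lt.1 h3
    exact mul_le_mul_of_nonneg_left (mul_le_mul_of_nonpos_left h2 (not_le.1 h4).le) (by positivity)

/-- The sum of the squared weights is controlled by the weighted count. -/
theorem sum_sq_le (h : IsStochasticSpectrum P lam u z) {ξ : ℕ → Fin M → ℝ}
    (hξ0 : ∀ τ j, 0 ≤ ξ τ j) (hξ1 : ∀ τ j, ξ τ j ≤ 1) (n : ℕ) (k : Fin M) :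
    M * ∑ τ ∈ Finset.range n, ∑ j, (P ^ (n - τ)) k j ^ 2 * ξ τ j ≤
      ∑ τ ∈ Finset.range n, ∑ j, (P ^ (n - τ)) k j * ξ τ j + epsC lam u k := by
  have hM : (0 : ℝ) < M := by exact_mod_cast k.pos
  -- Only one of the two factors of the square is separated into its leading part `1 / M` and the
  -- rest. The leading part reproduces the weight itself, and the rest gives the double sum in which
  -- only the second index omits `z`, as in `epsC`.
  have h1 : ∀ s j, M * (P ^ s) k j ^ 2 = (P ^ s) k j + M * ∑ p, ∑ w ∈ Finset.univ.erase z,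
      (lam p * lam w) ^ s * ((u p k * u w k) * (u p j * u w j)) := by
    intro s j
    have h2 : ∑ p, ∑ w ∈ Finset.univ.erase z,
        (lam p * lam w) ^ s * ((u p k * u w k) * (u p j * u w j))
        = (P ^ s) k j * ∑ w ∈ Finset.univ.erase z, lam w ^ s * (u w k * u w j) := by
      rw [h.basis.pow_apply, Finset.sum_mul_sum]
      exact Finset.sum_congr rfl fun p _ => Finset.sum_congr rfl fun w _ => by
        rw [mul_pow]; ring
    rw [h2, eq_sub_of_add_eq' (h.pow_apply s k j).symm]
    field_simp
    ring
  have h2 : M * ∑ τ ∈ Finset.range n, ∑ j, (P ^ (n - τ)) k j ^ 2 * ξ τ j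
      = ∑ τ ∈ Finset.range n, ∑ j, (P ^ (n - τ)) k j * ξ τ j
        + M * ∑ p, ∑ w ∈ Finset.univ.erase z, ∑ τ ∈ Finset.range n, (lam p * lam w) ^ (n - τ) *
          ((u p k * u w k) * ∑ j, u p j * u w j * ξ τ j) := by
    have h3 : ∀ τ, ∑ p, ∑ w ∈ Finset.univ.erase z, (lam p * lam w) ^ (n - τ) *
          ((u p k * u w k) * ∑ j, u p j * u w j * ξ τ j)
        = ∑ j, (∑ p, ∑ w ∈ Finset.univ.erase z,
          (lam p * lam w) ^ (n - τ) * ((u p k * u w k) * (u p j * u w j))) * ξ τ j := by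
      intro τ
      simp only [Finset.mul_sum, Finset.sum_mul]
      symm
      rw [Finset.sum_comm]
      refine Finset.sum_congr rfl fun p _ => ?_
      rw [Finset.sum_comm]
      exact Finset.sum_congr rfl fun w _ => Finset.sum_congr rfl fun j _ => by ring
    have h4 : ∀ p, ∑ w ∈ Finset.univ.erase z, ∑ τ ∈ Finset.range n, (lam p * lam w) ^ (n - τ) *
          ((u p k * u w k) * ∑ j, u p j * u w j * ξ τ j)
        = ∑ τ ∈ Finset.range n, ∑ w ∈ Finset.univ.erase z, (lam p * lam w) ^ (n - τ) *
          ((u p k * u w k) * ∑ j, u p j * u w j * ξ τ j) := fun p => Finset.sum_comm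
    rw [Finset.sum_congr rfl fun p _ => h4 p, Finset.sum_comm (t := Finset.range n),
      Finset.sum_congr rfl fun τ _ => h3 τ, Finset.mul_sum, Finset.mul_sum,
      ← Finset.sum_add_distrib]
    refine Finset.sum_congr rfl fun τ _ => ?_
    rw [Finset.mul_sum, Finset.mul_sum, ← Finset.sum_add_distrib]
    refine Finset.sum_congr rfl fun j _ => ?_
    rw [← mul_assoc, h1]
    ring
  rw [h2]
  gcongr
  rw [epsC, filter_ne_zero_eq h.index_zero]
  gcongr with p _ w hw
  calc ∑ τ ∈ Finset.range n, (lam p * lam w) ^ (n - τ) *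
          ((u p k * u w k) * ∑ j, u p j * u w j * ξ τ j)
      ≤ ∑ τ ∈ Finset.range n, |lam p * lam w| ^ (n - τ) * aCoef lam u p w k := by
        exact Finset.sum_le_sum fun τ _ => pow_mul_le_aCoef lam u p w k (hξ0 τ) (hξ1 τ) _
    _ ≤ _ := by
        rw [← Finset.sum_mul]
        have := aCoef_nonneg lam u p w k
        gcongr
        exact sum_geom_le (abs_nonneg _) (h.abs_mul_lt p (Finset.ne_of_mem_erase hw)) n

/-- All terms of `epsC` are nonnegative, and its diagonal terms are explicit because `nuPlus u p p`
is the squared norm of a unit vector. -/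
theorem epsC_ge (h : IsStochasticSpectrum P lam u z) (k : Fin M) :
    M * ∑ p ∈ Finset.univ.erase z, lam p ^ 2 / (1 - lam p ^ 2) * u p k ^ 2 ≤ epsC lam u k := by
  rw [epsC, filter_ne_zero_eq h.index_zero, Finset.sum_comm]
  have hnn : ∀ p, ∀ w ∈ Finset.univ.erase z,
      0 ≤ |lam p * lam w| / (1 - |lam p * lam w|) * aCoef lam u p w k := by
    intro p w hw
    have h1 := h.abs_mul_lt p (Finset.ne_of_mem_erase hw)
    have h2 := aCoef_nonneg lam u p w k
    have h3 : 0 ≤ 1 - |lam p * lam w| := by linarith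
    positivity
  gcongr with p hp
  refine le_trans (le_of_eq ?_) (Finset.single_le_sum (fun q _ => hnn q p hp) (Finset.mem_univ p))
  have h1 : nuPlus u p p = 1 := by
    rw [← h.basis.sum_sq p, nuPlus]
    exact Finset.sum_congr rfl fun d _ => by rw [if_pos (mul_self_nonneg _), sq]
  rw [aCoef, if_neg (not_lt.2 (mul_self_nonneg _)), if_pos (mul_self_nonneg _), h1,
    abs_of_nonneg (mul_self_nonneg _)]
  ring

/-- If every agent has contributed once, at pairwise different times, then the weighted count
cannot be small unless `epsC` is large. -/
theorem weighted_ge (h : IsStochasticSpectrum P lam u z) {ξ : ℕ → Fin M → ℝ}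
    (hξ0 : ∀ τ j, 0 ≤ ξ τ j) (n : ℕ) (k : Fin M) {t : Fin M → ℕ} (ht : Function.Injective t)
    (htn : ∀ j, t j < n) (htξ : ∀ j, ξ (t j) j = 1) :
    3 / 4 - epsC lam u k ≤ ∑ τ ∈ Finset.range n, ∑ j, (P ^ (n - τ)) k j * ξ τ j := by
  have hM : (0 : ℝ) < M := by exact_mod_cast k.pos
  have h1 : ∑ j, (P ^ (n - t j)) k j ≤ ∑ τ ∈ Finset.range n, ∑ j, (P ^ (n - τ)) k j * ξ τ j := by
    rw [Finset.sum_comm]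
    refine Finset.sum_le_sum fun j _ => ?_
    refine le_trans (le_of_eq ?_) (Finset.single_le_sum
      (f := fun τ => (P ^ (n - τ)) k j * ξ τ j)
      (fun τ _ => mul_nonneg (h.pow_nonneg _ _ _) (hξ0 τ j)) (Finset.mem_range.2 (htn j)))
    simp [htξ]
  refine le_trans ?_ h1
  have h2 : ∀ p ∈ Finset.univ.erase z,
      -(1 / (4 * M) + M * (lam p ^ 2 / (1 - lam p ^ 2) * u p k ^ 2))
        ≤ ∑ j, lam p ^ (n - t j) * (u p k * u p j) := by
    intro p hp
    -- A square completed with weights chosen so that the first parts add up to `1 / (4 * M)` per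
    -- eigenvector, hence to at most `1 / 4` in all, while the second parts fit under `epsC`.
    have h3 : ∀ j, -(u p j ^ 2 / (4 * M) + M * (u p k ^ 2 * (lam p ^ 2) ^ (n - t j)))
        ≤ lam p ^ (n - t j) * (u p k * u p j) := by
      intro j
      have h4 : 0 ≤ (u p j / (2 * M) + lam p ^ (n - t j) * u p k) ^ 2 * M := by positivity
      have h5 : (u p j / (2 * M) + lam p ^ (n - t j) * u p k) ^ 2 * M
          = u p j ^ 2 / (4 * M) + M * (u p k ^ 2 * (lam p ^ 2) ^ (n - t j))
            + lam p ^ (n - t j) * (u p k * u p j) := by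
        rw [← pow_mul, mul_comm 2, pow_mul]
        field_simp
        ring
      linarith
    refine le_trans ?_ (Finset.sum_le_sum fun j _ => h3 j)
    rw [Finset.sum_neg_distrib, Finset.sum_add_distrib, ← Finset.sum_div, h.basis.sum_sq,
      ← Finset.mul_sum, ← Finset.mul_sum, mul_comm (u p k ^ 2)]
    -- The times are pairwise different, so the powers are distinct terms of one geometric series.
    have h6 : ∑ j, (lam p ^ 2) ^ (n - t j) ≤ lam p ^ 2 / (1 - lam p ^ 2) := by
      have h7 : lam p ^ 2 < 1 := (sq_lt_one_iff_abs_lt_one _).2 (h.abs_lt p (Finset.ne_of_mem_erase hp))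
      refine le_trans ?_ (sum_geom_le (sq_nonneg _) h7 n)
      rw [← Finset.sum_image (f := fun τ => (lam p ^ 2) ^ (n - τ)) (g := t)
        (fun a _ b _ hab => ht hab)]
      refine Finset.sum_le_sum_of_subset_of_nonneg ?_ fun _ _ _ => by positivity
      intro τ hτ
      obtain ⟨j, -, rfl⟩ := Finset.mem_image.1 hτ
      exact Finset.mem_range.2 (htn j)
    gcongr
  have h3 := Finset.sum_le_sum h2
  rw [Finset.sum_neg_distrib, Finset.sum_add_distrib, ← Finset.mul_sum] at h3
  have h4 := h.epsC_ge k
  have h5 : ∑ _p ∈ Finset.univ.erase z, 1 / (4 * (M : ℝ)) ≤ 1 / 4 := by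
    rw [Finset.sum_const, Finset.card_erase_of_mem (Finset.mem_univ z), nsmul_eq_mul,
      Finset.card_univ, Fintype.card_fin]
    have h6 : ((M - 1 : ℕ) : ℝ) ≤ M := by exact_mod_cast Nat.sub_le _ _
    calc ((M - 1 : ℕ) : ℝ) * (1 / (4 * (M : ℝ))) ≤ M * (1 / (4 * (M : ℝ))) := by gcongr
      _ = 1 / 4 := by field_simp
  have h6 : ∑ j, (P ^ (n - t j)) k j
      = 1 + ∑ p ∈ Finset.univ.erase z, ∑ j, lam p ^ (n - t j) * (u p k * u p j) := by
    simp only [h.pow_apply]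
    rw [Finset.sum_add_distrib, Finset.sum_comm]
    simp [hM.ne']
  rw [h6]
  linarith

end IsStochasticSpectrum
end Estimates

/-! ### Series and calculus -/

/-- Comparison with a primitive by the mean value theorem: each increment of `F` over a unit step is
a value of `g` at an interior point, which is at least its value at the right end. -/
theorem sum_Ico_le_sub_of_hasDerivAt {F g : ℝ → ℝ} {a : ℕ}
    (hF : ∀ x : ℝ, a ≤ x → HasDerivAt F (g x) x) (hg : AntitoneOn g (Set.Ici (a : ℝ))) {n : ℕ}
    (hn : a ≤ n) : ∑ s ∈ Finset.Ico (a + 1) (n + 1), g s ≤ F n - F a := by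
  induction n, hn using Nat.le_induction with
  | base => simp
  | succ n hn ih =>
    rw [Finset.sum_Ico_succ_top (by omega)]
    have hna : (a : ℝ) ≤ n := by exact_mod_cast hn
    obtain ⟨c, hc, hc'⟩ := exists_hasDerivAt_eq_slope F g (a := (n : ℝ)) (b := ((n + 1 : ℕ) : ℝ))
      (by push_cast; linarith)
      (fun x hx => (hF x (hna.trans hx.1)).continuousAt.continuousWithinAt)
      (fun x hx => hF x (hna.trans hx.1.le))
    have h1 : g ((n + 1 : ℕ) : ℝ) ≤ g c :=
      hg (hna.trans hc.1.le) (hna.trans (hc.1.le.trans hc.2.le)) hc.2.le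
    rw [hc'] at h1
    push_cast at h1 ⊢
    rw [add_sub_cancel_left, div_one] at h1
    linarith

theorem sum_one_div_rpow_le {γ : ℝ} (hγ : 1 < γ) (T : ℕ) :
    ∑ s ∈ Finset.Ico 2 T, 1 / (s : ℝ) ^ γ ≤ 1 / (γ - 1) := by
  have hγ' : 0 < γ - 1 := by linarith
  rcases Nat.lt_or_ge T 2 with hT | hT
  · rw [Finset.Ico_eq_empty_of_le hT.le]; simpa using hγ'.le
  obtain ⟨n, rfl⟩ : ∃ n, T = n + 1 := ⟨T - 1, by omega⟩
  have h := sum_Ico_le_sub_of_hasDerivAt (F := fun x => -(1 / (γ - 1)) * x ^ (1 - γ))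
    (g := fun x => 1 / x ^ γ) (a := 1) (n := n) ?_ ?_ (by omega)
  · simp only [Nat.cast_one, Real.one_rpow, mul_one, sub_neg_eq_add] at h
    have : 0 ≤ 1 / (γ - 1) * (n : ℝ) ^ (1 - γ) := by positivity
    refine h.trans ?_
    linarith
  · intro x hx
    have hx0 : 0 < x := by push_cast at hx; linarith
    have h1 := (Real.hasDerivAt_rpow_const (x := x) (p := 1 - γ) (Or.inl hx0.ne')).const_mul
      (-(1 / (γ - 1)))
    convert! h1 using 1
    rw [show 1 - γ - 1 = -γ by ring, Real.rpow_neg hx0.le]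
    field_simp
    ring
  · intro x hx y hy hxy
    have hx0 : (0 : ℝ) < x := by have := Set.mem_Ici.1 hx; push_cast at this; linarith
    simp only
    gcongr

theorem sum_log_div_rpow_le {γ : ℝ} (hγ : 1 < γ) (T : ℕ) :
    ∑ s ∈ Finset.Ico 2 T, Real.log s / (s : ℝ) ^ γ ≤ 1 / (γ - 1) ^ 2 + 1 := by
  have hγ' : 0 < γ - 1 := by linarith
  have hnn : ∀ s : ℕ, 0 ≤ Real.log s / (s : ℝ) ^ γ := fun s =>
    div_nonneg (Real.log_natCast_nonneg s) (by positivity)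
  -- The function `log x / x ^ γ` decreases only from `exp (1 / γ)` on, and this is below `3`. The
  -- terms at `2` and `3` are therefore bounded by `1 / 2` each, which gives the summand `1`.
  obtain ⟨n, hTn, hn⟩ : ∃ n, T ≤ n + 1 ∧ 3 ≤ n := ⟨T + 3, by omega, by omega⟩
  have h := sum_Ico_le_sub_of_hasDerivAt
    (F := fun x => -((Real.log x / (γ - 1) + 1 / (γ - 1) ^ 2) * x ^ (1 - γ)))
    (g := fun x => Real.log x / x ^ γ) (a := 3) (n := n) ?_ ?_ hn
  · have h1 : ∑ s ∈ Finset.Ico 2 T, Real.log s / (s : ℝ) ^ γ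
        ≤ ∑ s ∈ Finset.Ico 2 (n + 1), Real.log s / (s : ℝ) ^ γ :=
      Finset.sum_le_sum_of_subset_of_nonneg (Finset.Ico_subset_Ico_right hTn) fun s _ _ => hnn s
    rw [Finset.sum_eq_sum_Ico_succ_bot (a := 2) (b := n + 1) (by omega),
      Finset.sum_eq_sum_Ico_succ_bot (a := 2 + 1) (b := n + 1) (by omega)] at h1
    have h2 : Real.log ((2 : ℕ) : ℝ) / ((2 : ℕ) : ℝ) ^ γ ≤ 1 / 2 := by
      rw [div_le_div_iff₀ (by positivity) two_pos]
      have h3 : (2 : ℝ) ≤ 2 ^ γ := by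
        simpa using Real.rpow_le_rpow_of_exponent_le (x := 2) (by norm_num) hγ.le
      have := Real.log_two_lt_d9
      push_cast
      nlinarith
    have h3 : Real.log ((2 + 1 : ℕ) : ℝ) / ((2 + 1 : ℕ) : ℝ) ^ γ ≤ 1 / 2 := by
      rw [div_le_div_iff₀ (by positivity) two_pos]
      have h3 : (3 : ℝ) ≤ 3 ^ γ := by
        simpa using Real.rpow_le_rpow_of_exponent_le (x := 3) (by norm_num) hγ.le
      have h4 : Real.log 3 ≤ 2 * Real.log 2 := by
        have : Real.log 4 = 2 * Real.log 2 := by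
          rw [show (4 : ℝ) = 2 ^ 2 by norm_num, Real.log_pow]; norm_num
        rw [← this]
        exact Real.log_le_log (by norm_num) (by norm_num)
      have := Real.log_two_lt_d9
      norm_num
      nlinarith
    have h4 : 0 ≤ (Real.log (n : ℝ) / (γ - 1) + 1 / (γ - 1) ^ 2) * (n : ℝ) ^ (1 - γ) := by
      have := Real.log_natCast_nonneg n
      positivity
    -- The boundary term at `3` reduces to `1 + y ≤ exp y` with `y = log 3 * (γ - 1)`.
    have h5 : (Real.log 3 / (γ - 1) + 1 / (γ - 1) ^ 2) * (3 : ℝ) ^ (1 - γ) ≤ 1 / (γ - 1) ^ 2 := by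
      have h6 : (3 : ℝ) ^ (1 - γ) = (Real.exp (Real.log 3 * (γ - 1)))⁻¹ := by
        rw [Real.rpow_def_of_pos (by norm_num), ← Real.exp_neg]
        congr 1; ring
      have h7 := Real.add_one_le_exp (Real.log 3 * (γ - 1))
      rw [h6, ← div_eq_mul_inv, div_le_iff₀ (Real.exp_pos _)]
      calc Real.log 3 / (γ - 1) + 1 / (γ - 1) ^ 2
          = 1 / (γ - 1) ^ 2 * (Real.log 3 * (γ - 1) + 1) := by field_simp
        _ ≤ _ := by gcongr
    simp only [Nat.cast_ofNat] at h
    have h6 : Finset.Ico (2 + 1 + 1) (n + 1) = Finset.Ico (3 + 1) (n + 1) := rfl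
    rw [h6] at h1
    linarith
  · intro x hx
    have hx0 : 0 < x := by push_cast at hx; linarith
    have h1 := (((Real.hasDerivAt_log hx0.ne').div_const (γ - 1)).add_const (1 / (γ - 1) ^ 2)).mul
      (Real.hasDerivAt_rpow_const (x := x) (p := 1 - γ) (Or.inl hx0.ne'))
    have h2 := h1.neg
    convert! h2 using 1
    rw [show 1 - γ - 1 = -γ by ring, show 1 - γ = -γ + 1 by ring, Real.rpow_add hx0,
      Real.rpow_neg hx0.le, Real.rpow_one]
    field_simp
    ring
  · refine (Real.log_div_self_rpow_antitoneOn (a := γ) (by linarith)).mono ?_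
    refine Set.Ici_subset_Ici.2 ?_
    have h1 : Real.exp γ⁻¹ ≤ Real.exp 1 := Real.exp_le_exp.2 (inv_le_one_of_one_le₀ hγ.le)
    have := Real.exp_one_lt_d9
    push_cast
    linarith

theorem gEta_pos {η : ℝ} (hη0 : 0 < η) (hη4 : η < 4) : 0 < gEta η := by
  rw [gEta]; nlinarith

/-- Summation of the tail probabilities over the rounds. -/
theorem sum_peel_le {γ η : ℝ} (hγ : 1 < γ) (hη0 : 0 < η) {N : ℕ} (hN : 2 ≤ N) (T : ℕ) :
    ∑ s ∈ Finset.Ico N T, (2 * Real.log s / Real.log (1 + η) + 1) * (1 / (s : ℝ) ^ γ) ≤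
      2 / Real.log (1 + η) * (1 / (γ - 1) ^ 2 + γ * Real.log (1 + η) / (γ - 1) + 1) := by
  have hγ' : 0 < γ - 1 := by linarith
  have hl : 0 < Real.log (1 + η) := Real.log_pos (by linarith)
  have h1 : ∑ s ∈ Finset.Ico N T, (2 * Real.log s / Real.log (1 + η) + 1) * (1 / (s : ℝ) ^ γ)
      ≤ ∑ s ∈ Finset.Ico 2 T, (2 * Real.log s / Real.log (1 + η) + 1) * (1 / (s : ℝ) ^ γ) := by
    refine Finset.sum_le_sum_of_subset_of_nonneg (Finset.Ico_subset_Ico_left hN) fun s _ _ => ?_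
    have := Real.log_natCast_nonneg s
    positivity
  refine h1.trans ?_
  have h2 : ∑ s ∈ Finset.Ico 2 T, (2 * Real.log s / Real.log (1 + η) + 1) * (1 / (s : ℝ) ^ γ)
      = 2 / Real.log (1 + η) * ∑ s ∈ Finset.Ico 2 T, Real.log s / (s : ℝ) ^ γ
        + ∑ s ∈ Finset.Ico 2 T, 1 / (s : ℝ) ^ γ := by
    rw [Finset.mul_sum, ← Finset.sum_add_distrib]
    exact Finset.sum_congr rfl fun s _ => by ring
  rw [h2]
  have h3 := sum_log_div_rpow_le hγ T
  have h4 := sum_one_div_rpow_le hγ T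
  calc 2 / Real.log (1 + η) * ∑ s ∈ Finset.Ico 2 T, Real.log s / (s : ℝ) ^ γ
        + ∑ s ∈ Finset.Ico 2 T, 1 / (s : ℝ) ^ γ
      -- The second series is enlarged from `1 / (γ - 1)` to `2 * γ / (γ - 1)` to match the form of
      -- `lBar`.
      ≤ 2 / Real.log (1 + η) * (1 / (γ - 1) ^ 2 + 1) + 2 * γ * (1 / (γ - 1)) := by
        gcongr
        refine h4.trans (le_mul_of_one_le_left (by positivity) (by linarith))
    _ = _ := by field_simp; ring

/-- The confidence width is at most `Δ / 2` once the count is large enough. -/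
theorem confWidth_le {M : ℕ} (hM : 0 < M) {σ γ η Δ F L x : ℝ} {f : ℝ → ℝ} {n : ℕ} (hσ : 0 < σ)
    (hγ : 0 < γ) (hη : 0 < gEta η) (hΔ : 0 < Δ) (hL : 0 < L) (hnL : Real.log n ≤ L)
    (hf0 : 0 ≤ f n) (hf : f n ≤ F)
    (hx : 4 * σ ^ 2 * γ / (Δ ^ 2 * gEta η) *
      (1 + √(1 + Δ ^ 2 * M * gEta η / (2 * σ ^ 2 * γ) * (F / L))) * L ≤ M * x) :
    0 < x ∧ confWidth M σ γ η f n x ≤ Δ / 2 := by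
  have hM' : (0 : ℝ) < M := by exact_mod_cast hM
  have hF : 0 ≤ F := hf0.trans hf
  set g := gEta η
  -- With this `c`, width at most `Δ / 2` follows from `c * (x + F) ≤ x ^ 2`. The larger root of
  -- that quadratic is `c / 2 * (1 + √(1 + 4 * F / c))`, and the threshold in `hx` is `M` times this
  -- root.
  set c : ℝ := 8 * σ ^ 2 * γ * L / (M * g * Δ ^ 2) with hc
  have hc0 : 0 < c := by positivity
  have hx0 : 0 < x := by
    have : 0 < 4 * σ ^ 2 * γ / (Δ ^ 2 * g) *
      (1 + √(1 + Δ ^ 2 * M * g / (2 * σ ^ 2 * γ) * (F / L))) * L := by positivity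
    exact pos_of_mul_pos_right (this.trans_le hx) hM'.le
  refine ⟨hx0, ?_⟩
  have h1 : 1 + √(1 + 4 * F / c) ≤ 2 * x / c := by
    have h2 : Δ ^ 2 * M * g / (2 * σ ^ 2 * γ) * (F / L) = 4 * F / c := by
      rw [hc]; field_simp; ring
    rw [h2] at hx
    have h3 : 4 * σ ^ 2 * γ / (Δ ^ 2 * g) * (1 + √(1 + 4 * F / c)) * L
        = M * (c / 2) * (1 + √(1 + 4 * F / c)) := by
      rw [show 4 * σ ^ 2 * γ / (Δ ^ 2 * g) * (1 + √(1 + 4 * F / c)) * L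
        = 4 * σ ^ 2 * γ / (Δ ^ 2 * g) * L * (1 + √(1 + 4 * F / c)) by ring]
      congr 1
      rw [hc]; field_simp; ring
    rw [h3, mul_assoc, mul_le_mul_iff_right₀ hM'] at hx
    rw [le_div_iff₀ hc0]
    linarith
  have h2 : c * (x + F) ≤ x ^ 2 := by
    have h3 : 1 + 4 * F / c ≤ (2 * x / c - 1) ^ 2 := by
      rw [← Real.sqrt_le_left (by linarith [Real.sqrt_nonneg (1 + 4 * F / c)])]
      linarith
    have h4 : (2 * x / c - 1) ^ 2 - (1 + 4 * F / c) = 4 / c ^ 2 * (x ^ 2 - c * (x + F)) := by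
      field_simp; ring
    have h5 : 0 ≤ 4 / c ^ 2 * (x ^ 2 - c * (x + F)) := by rw [← h4]; linarith
    have h6 : (0 : ℝ) < 4 / c ^ 2 := by positivity
    have := (mul_nonneg_iff_of_pos_left h6).1 h5
    linarith
  rw [confWidth]
  have h3 : 2 * γ / g * ((x + f n) / (M * x)) * (Real.log n / x) ≤ (Δ / (2 * σ)) ^ 2 := by
    calc 2 * γ / g * ((x + f n) / (M * x)) * (Real.log n / x)
        ≤ 2 * γ / g * ((x + F) / (M * x)) * (L / x) := by gcongr
      _ = (Δ / (2 * σ)) ^ 2 * (c * (x + F) / x ^ 2) := by rw [hc]; field_simp; ring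
      _ ≤ (Δ / (2 * σ)) ^ 2 * 1 := by
          gcongr
          exact (div_le_one (by positivity)).2 h2
      _ = _ := mul_one _
  calc σ * √(2 * γ / g * ((x + f n) / (M * x)) * (Real.log n / x))
      ≤ σ * √((Δ / (2 * σ)) ^ 2) := by gcongr
    _ = Δ / 2 := by rw [Real.sqrt_sq (by positivity)]; field_simp

/-- Multiplied by the count, the width takes the form `σ * √(2 * ℓ / gEta η * Y)` required for
peeling, with `ℓ = γ * log n` and `Y = (x + f n) / M`. -/
theorem confWidth_mul {M : ℕ} {σ γ η : ℝ} {f : ℝ → ℝ} {n : ℕ} {x : ℝ} (hx : 0 < x) :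
    confWidth M σ γ η f n x * x =
      σ * √(2 * (γ * Real.log n) / gEta η * ((x + f n) / M)) := by
  rw [confWidth, mul_assoc]
  congr 1
  rw [show ∀ y : ℝ, y * x = y * √(x ^ 2) by simp [Real.sqrt_sq hx.le],
    ← Real.sqrt_mul' _ (sq_nonneg x)]
  congr 1
  field_simp

theorem minGap_spec {N : ℕ} (hN : 2 ≤ N) {m : Fin N → ℝ} (hm : Function.Injective m) :
    0 < minGap m ∧ ∀ i j, i ≠ j → minGap m ≤ |m i - m j| := by
  have : Nonempty {q : Fin N × Fin N // q.1 ≠ q.2} :=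
    ⟨⟨(⟨0, by omega⟩, ⟨1, by omega⟩), by simp⟩⟩
  constructor
  · obtain ⟨q, hq⟩ := exists_eq_ciInf_of_finite
      (f := fun q : {q : Fin N × Fin N // q.1 ≠ q.2} => |m q.1.1 - m q.1.2|)
    rw [minGap, ← hq]
    exact abs_pos.2 (sub_ne_zero.2 (hm.ne q.2))
  · intro i j hij
    exact ciInf_le (Set.finite_range _).bddBelow
      (⟨(i, j), hij⟩ : {q : Fin N × Fin N // q.1 ≠ q.2})

/-! ### Self-normalized concentration -/

section Concentration

variable {Ω : Type*}

/-- The sigma-algebra of the rewards of the (round, agent) pairs in `S`. -/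
abbrev rewardsIn {N M : ℕ} (r : ℕ → Fin N → Fin M → Ω → ℝ) (S : Set (ℕ × Fin M)) :
    MeasurableSpace Ω :=
  ⨆ q ∈ S, MeasurableSpace.comap (fun ω i => r q.1 i q.2 ω) inferInstance

section Rewards

variable {N M : ℕ} {r : ℕ → Fin N → Fin M → Ω → ℝ}

theorem rewardsIn_mono {S T : Set (ℕ × Fin M)} (h : S ⊆ T) : rewardsIn r S ≤ rewardsIn r T :=
  biSup_mono h

theorem measurable_rewardsIn {S : Set (ℕ × Fin M)} {q : ℕ × Fin M} (hq : q ∈ S) (i : Fin N) :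
    Measurable[rewardsIn r S] (r q.1 i q.2) := by
  have h1 : Measurable[rewardsIn r S] (fun ω i => r q.1 i q.2 ω) :=
    Measurable.of_comap_le (le_iSup₂_of_le q hq le_rfl)
  exact (measurable_pi_apply i).comp h1

theorem pastRewards_le_rewardsIn (n : ℕ) :
    pastRewards r n ≤ rewardsIn r {q : ℕ × Fin M | q.1 < n} :=
  iSup₂_le fun s hs => iSup₂_le fun i k =>
    (measurable_rewardsIn (r := r) (q := (s, k)) hs i).comap_le

theorem measurableSet_sel {sel : ℕ → Fin M → Ω → Fin N} (hsel : DependsOnPast r sel) (n : ℕ) (j : Fin M) (i : Fin N) :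
    MeasurableSet[rewardsIn r {q : ℕ × Fin M | q.1 < n}] {ω | sel n j ω = i} :=
  pastRewards_le_rewardsIn n _ (hsel n j (measurableSet_singleton i))

end Rewards

variable [mΩ : MeasurableSpace Ω] {μ : Measure Ω}

/-- One supermartingale step, without conditional expectations: on the past event `E` the new factor
is independent of `A` and has mean at most one, and off `E` it is `1`. -/
theorem lintegral_mul_ite_le {mS mq : MeasurableSpace Ω} (hS : mS ≤ mΩ) (hq : mq ≤ mΩ)
    (hind : Indep mS mq μ) {A : Ω → ENNReal} (hA : Measurable[mS] A) {E : Set Ω}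
    [∀ ω, Decidable (ω ∈ E)] (hE : MeasurableSet[mS] E) {H : Ω → ENNReal} (hH : Measurable[mq] H)
    (hH1 : ∫⁻ ω, H ω ∂μ ≤ 1) :
    ∫⁻ ω, A ω * (if ω ∈ E then H ω else 1) ∂μ ≤ ∫⁻ ω, A ω ∂μ := by
  have hAE : Measurable[mS] (E.indicator A) := hA.indicator hE
  calc ∫⁻ ω, A ω * (if ω ∈ E then H ω else 1) ∂μ
      = ∫⁻ ω, (E.indicator A ω * H ω + Eᶜ.indicator A ω) ∂μ := by
        refine lintegral_congr fun ω => ?_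
        by_cases h : ω ∈ E <;> simp [h]
    _ = (∫⁻ ω, E.indicator A ω ∂μ) * ∫⁻ ω, H ω ∂μ + ∫⁻ ω, Eᶜ.indicator A ω ∂μ := by
        rw [lintegral_add_left (f := fun ω => E.indicator A ω * H ω)
            ((hAE.mono hS le_rfl).mul (hH.mono hq le_rfl)),
          lintegral_mul_eq_lintegral_mul_lintegral_of_independent_measurableSpace hS hq hind hAE hH]
    _ ≤ (∫⁻ ω, E.indicator A ω ∂μ) * 1 + ∫⁻ ω, Eᶜ.indicator A ω ∂μ := by gcongr
    _ = ∫⁻ ω, A ω ∂μ := by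
        rw [mul_one, ← lintegral_add_left (hAE.mono hS le_rfl)]
        refine lintegral_congr fun ω => ?_
        by_cases h : ω ∈ E <;> simp [h]

section Rewards

variable {N M : ℕ} {r : ℕ → Fin N → Fin M → Ω → ℝ} {sel : ℕ → Fin M → Ω → Fin N}

theorem rewardsIn_le (hr : ∀ n i k, Measurable (r n i k)) (S : Set (ℕ × Fin M)) :
    rewardsIn r S ≤ mΩ :=
  iSup₂_le fun q _ => (measurable_pi_lambda _ fun i => hr q.1 i q.2).comap_le

theorem indep_rewardsIn [IsProbabilityMeasure μ] (hr : ∀ n i k, Measurable (r n i k))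
    (hind : iIndepFun (fun (q : ℕ × Fin M) ω i => r q.1 i q.2 ω) μ) {S T : Set (ℕ × Fin M)}
    (h : Disjoint S T) : Indep (rewardsIn r S) (rewardsIn r T) μ :=
  indep_iSup_of_disjoint
    (m := fun q : ℕ × Fin M => MeasurableSpace.comap (fun ω i => r q.1 i q.2 ω) inferInstance)
    (fun q => (measurable_pi_lambda _ fun i => hr q.1 i q.2).comap_le) hind.iIndep h

theorem measurable_sel (hr : ∀ n i k, Measurable (r n i k)) (hsel : DependsOnPast r sel) (n : ℕ)
    (j : Fin M) : Measurable (sel n j) :=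
  (hsel n j).mono ((pastRewards_le_rewardsIn n).trans (rewardsIn_le hr _)) le_rfl

/-- The exponential process attached to factors `H` of mean at most one, each switched on by the
selection of arm `i`, has mean at most one. -/
theorem lintegral_prod_ite_le [IsProbabilityMeasure μ] (hr : ∀ n i k, Measurable (r n i k))
    (hind : iIndepFun (fun (q : ℕ × Fin M) ω i => r q.1 i q.2 ω) μ) (hsel : DependsOnPast r sel)
    (i : Fin N) {H : ℕ → Fin M → Ω → ENNReal}
    (hH : ∀ τ j, Measurable[rewardsIn r {(τ, j)}] (H τ j)) (hH1 : ∀ τ j, ∫⁻ ω, H τ j ω ∂μ ≤ 1)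
    (n : ℕ) :
    Measurable[rewardsIn r {q : ℕ × Fin M | q.1 < n}]
      (fun ω => ∏ τ ∈ Finset.range n, ∏ j, if sel τ j ω = i then H τ j ω else 1) ∧
    ∫⁻ ω, ∏ τ ∈ Finset.range n, ∏ j, (if sel τ j ω = i then H τ j ω else 1) ∂μ ≤ 1 := by
  induction n with
  | zero => simp
  | succ n ih =>
    simp only [Finset.prod_range_succ]
    -- Within a round the agents are added one at a time. The selections of the round are known from
    -- earlier rounds, and the reward of the next agent is independent of everything accumulated so
    -- far.
    have key : ∀ J : Finset (Fin M),
        Measurable[rewardsIn r {q : ℕ × Fin M | q.1 < n ∨ q.1 = n ∧ q.2 ∈ J}]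
          (fun ω => (∏ τ ∈ Finset.range n, ∏ j, if sel τ j ω = i then H τ j ω else 1) *
            ∏ j ∈ J, if sel n j ω = i then H n j ω else 1) ∧
        ∫⁻ ω, (∏ τ ∈ Finset.range n, ∏ j, if sel τ j ω = i then H τ j ω else 1) *
            ∏ j ∈ J, (if sel n j ω = i then H n j ω else 1) ∂μ ≤ 1 := by
      intro J
      induction J using Finset.induction_on with
      | empty =>
        simp only [Finset.prod_empty, mul_one]
        exact ⟨ih.1.mono (rewardsIn_mono fun q hq => Or.inl hq) le_rfl, ih.2⟩
      | insert j J hj ihJ =>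
        have hE : MeasurableSet[rewardsIn r {q : ℕ × Fin M | q.1 < n ∨ q.1 = n ∧ q.2 ∈ J}]
            {ω | sel n j ω = i} :=
          rewardsIn_mono (fun q hq => Or.inl hq) _ (measurableSet_sel hsel n j i)
        have heq : ∀ ω, (∏ τ ∈ Finset.range n, ∏ j, if sel τ j ω = i then H τ j ω else 1) *
              ∏ j' ∈ insert j J, (if sel n j' ω = i then H n j' ω else 1)
            = ((∏ τ ∈ Finset.range n, ∏ j, if sel τ j ω = i then H τ j ω else 1) *
              ∏ j ∈ J, (if sel n j ω = i then H n j ω else 1)) *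
              (if ω ∈ {ω | sel n j ω = i} then H n j ω else 1) := by
          intro ω
          rw [Finset.prod_insert hj, mul_comm (ite _ _ _), mul_assoc]
          rfl
        simp only [heq]
        constructor
        · refine Measurable.mul (ihJ.1.mono (rewardsIn_mono ?_) le_rfl) (Measurable.ite
            (rewardsIn_mono ?_ _ hE) ((hH n j).mono (rewardsIn_mono ?_) le_rfl) measurable_const)
          · rintro q (h | h)
            · exact Or.inl h
            · exact Or.inr ⟨h.1, Finset.mem_insert_of_mem h.2⟩
          · rintro q (h | h)
            · exact Or.inl h
            · exact Or.inr ⟨h.1, Finset.mem_insert_of_mem h.2⟩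
          · rintro q rfl
            exact Or.inr ⟨rfl, Finset.mem_insert_self _ _⟩
        · refine (lintegral_mul_ite_le (rewardsIn_le hr _) (rewardsIn_le hr _)
            (indep_rewardsIn hr hind ?_) ihJ.1 hE (hH n j) (hH1 n j)).trans ihJ.2
          rw [Set.disjoint_singleton_right]
          rintro (h | h)
          · exact lt_irrefl _ h
          · exact hj h.2
    have hk := key Finset.univ
    refine ⟨hk.1.mono (rewardsIn_mono ?_) le_rfl, hk.2⟩
    rintro q (h | h)
    · exact Nat.lt_succ_of_lt h
    · exact h.1.symm ▸ Nat.lt_succ_self _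

theorem IsSubGaussianLaw.integrable {p : Measure ℝ} {σ : ℝ} (h : IsSubGaussianLaw p σ) :
    Integrable (fun x => x) p := by
  have h1 : integrableExpSet id p = Set.univ := by
    ext β; simpa [integrableExpSet] using (h β).1
  have := integrable_pow_of_mem_interior_integrableExpSet (X := id) (μ := p) (by simp [h1]) 1
  simpa using this

theorem IsSubGaussianLaw.lintegral_exp_le {p : Measure ℝ} [IsProbabilityMeasure p] {σ : ℝ}
    (h : IsSubGaussianLaw p σ) (β : ℝ) :
    ∫⁻ x, ENNReal.ofReal (Real.exp (β * (x - ∫ y, y ∂p) - σ ^ 2 * β ^ 2 / 2)) ∂p ≤ 1 := by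
  set m := ∫ y, y ∂p
  have h1 : ∀ x, Real.exp (β * (x - m) - σ ^ 2 * β ^ 2 / 2)
      = Real.exp (-(m * β + σ ^ 2 * β ^ 2 / 2)) * Real.exp (β * x) := by
    intro x; rw [← Real.exp_add]; congr 1; ring
  simp only [h1]
  rw [← ofReal_integral_eq_lintegral_ofReal ((h β).1.const_mul _)
    (Filter.Eventually.of_forall fun x => by positivity), integral_const_mul]
  have h2 : ∫ x, Real.exp (β * x) ∂p ≤ Real.exp (m * β + σ ^ 2 * β ^ 2 / 2) := by
    have h3 : 0 < ∫ x, Real.exp (β * x) ∂p := mgf_pos (X := id) (h β).1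
    rw [← Real.log_le_iff_le_exp h3]
    exact (h β).2
  rw [← ENNReal.ofReal_one]
  refine ENNReal.ofReal_le_ofReal ?_
  rw [Real.exp_neg, inv_mul_le_iff₀ (Real.exp_pos _), mul_one]
  exact h2

/-- The exponential moment of a weighted sum of the centered rewards of arm `i` is dominated by its
quadratic compensator. -/
theorem lintegral_exp_weighted_le [IsProbabilityMeasure μ] (hr : ∀ n i k, Measurable (r n i k))
    (hind : iIndepFun (fun (q : ℕ × Fin M) ω i => r q.1 i q.2 ω) μ) (hsel : DependsOnPast r sel)
    {i : Fin N} {p : Measure ℝ} {σ : ℝ} (hp : IsSubGaussianLaw p σ)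
    (hlaw : ∀ n k, μ.map (r n i k) = p) (w : ℕ → Fin M → ℝ) (β : ℝ) (n : ℕ) :
    ∫⁻ ω, ENNReal.ofReal (Real.exp (
      β * (∑ τ ∈ Finset.range n, ∑ j,
        w τ j * (r τ i j ω - ∫ x, x ∂p) * (if sel τ j ω = i then 1 else 0)) -
      β ^ 2 * σ ^ 2 / 2 * ∑ τ ∈ Finset.range n, ∑ j,
        w τ j ^ 2 * (if sel τ j ω = i then 1 else 0))) ∂μ ≤ 1 := by
  set m := ∫ x, x ∂p
  let h : ℕ → Fin M → ℝ → ENNReal := fun τ j x =>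
    ENNReal.ofReal (Real.exp (β * w τ j * (x - m) - σ ^ 2 * (β * w τ j) ^ 2 / 2))
  have hmeas : ∀ τ j, Measurable (h τ j) := fun τ j => by fun_prop
  have h1 := (lintegral_prod_ite_le hr hind hsel i (H := fun τ j ω => h τ j (r τ i j ω))
    (fun τ j => (hmeas τ j).comp (measurable_rewardsIn (q := (τ, j)) (Set.mem_singleton _) i))
    (fun τ j => by
      have hprob : IsProbabilityMeasure p :=
        hlaw τ j ▸ Measure.isProbabilityMeasure_map (hr τ i j).aemeasurable
      rw [← lintegral_map (hmeas τ j) (hr τ i j), hlaw]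
      exact hp.lintegral_exp_le (β * w τ j)) n).2
  refine le_trans (le_of_eq (lintegral_congr fun ω => ?_)) h1
  rw [Finset.mul_sum, Finset.mul_sum, ← Finset.sum_sub_distrib, Real.exp_sum,
    ENNReal.ofReal_prod_of_nonneg fun _ _ => (Real.exp_pos _).le]
  refine Finset.prod_congr rfl fun τ _ => ?_
  rw [Finset.mul_sum, Finset.mul_sum, ← Finset.sum_sub_distrib, Real.exp_sum,
    ENNReal.ofReal_prod_of_nonneg fun _ _ => (Real.exp_pos _).le]
  refine Finset.prod_congr rfl fun j _ => ?_
  split_ifs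
  · simp only [h]
    congr 2
    ring
  · simp

end Rewards

/-- Chernoff bound on one peeling cell. -/
theorem measure_cell_le {σ η ℓ a : ℝ} (hσ : 0 < σ) (hη0 : 0 < η) (hη4 : η < 4) (hℓ : 0 ≤ ℓ)
    (ha : 0 < a) {Z V Y : Ω → ℝ} (hZ : Measurable Z) (hV : Measurable V)
    (hexp : ∀ β, ∫⁻ ω, ENNReal.ofReal (Real.exp (β * Z ω - β ^ 2 * σ ^ 2 / 2 * V ω)) ∂μ ≤ 1)
    {E : Set Ω} (hE : ∀ ω ∈ E, V ω ≤ Y ω ∧ a ≤ Y ω ∧ Y ω ≤ a * (1 + η) ∧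
      σ * √(2 * ℓ / gEta η * Y ω) ≤ Z ω) :
    μ E ≤ ENNReal.ofReal (Real.exp (-ℓ)) := by
  have hG := gEta_pos hη0 hη4
  set g := gEta η with hg
  set q := √(1 + η) with hq
  have hq2 : q ^ 2 = 1 + η := Real.sq_sqrt (by linarith)
  have hq1 : 1 < q := by rw [hq, Real.lt_sqrt] <;> linarith
  -- On the cell, `√Y` runs from `√a` to `q * √a`; `c` is the midpoint, and `β` is the optimal
  -- Chernoff parameter for `√Y = c`.
  set c : ℝ := (1 + q) / 2 * √a with hc
  have hsa : 0 < √a := Real.sqrt_pos.2 ha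
  have hc0 : 0 < c := by positivity
  set d := √(2 * ℓ / g) with hd
  have hd2 : d ^ 2 = 2 * ℓ / g := Real.sq_sqrt (by positivity)
  have hd0 : 0 ≤ d := Real.sqrt_nonneg _
  set β : ℝ := d / (σ * c) with hβ
  have hβ0 : 0 ≤ β := by positivity
  have hsub : E ⊆ {ω | ENNReal.ofReal (Real.exp ℓ) ≤
      ENNReal.ofReal (Real.exp (β * Z ω - β ^ 2 * σ ^ 2 / 2 * V ω))} := by
    intro ω hω
    obtain ⟨h1, h2, h3, h4⟩ := hE ω hω
    refine ENNReal.ofReal_le_ofReal (Real.exp_le_exp.2 ?_)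
    have hY : 0 < Y ω := ha.trans_le h2
    set y := √(Y ω) with hy
    have hy2 : y ^ 2 = Y ω := Real.sq_sqrt hY.le
    have hay : √a ≤ y := Real.sqrt_le_sqrt h2
    have hya : y ≤ √a * q := by
      rw [hq, ← Real.sqrt_mul ha.le]; exact Real.sqrt_le_sqrt h3
    rw [Real.sqrt_mul (by positivity), ← hd] at h4
    set x := y / c with hx
    have hyx : y = x * c := by rw [hx]; field_simp
    have h5 : d ^ 2 * (x - x ^ 2 / 2) ≤ β * Z ω - β ^ 2 * σ ^ 2 / 2 * V ω := by
      have h6 : β * (σ * (d * y)) - β ^ 2 * σ ^ 2 / 2 * Y ω = d ^ 2 * (x - x ^ 2 / 2) := by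
        rw [← hy2, hyx, hβ]; field_simp
      rw [← h6]
      gcongr
    -- The relative distance from the midpoint is at most `(q - 1) / (q + 1)`, and this is at most
    -- `η / 4` since `η = (q - 1) * (q + 1)` and `q ≥ 1`. The loss in the exponent is the term `η ^
    -- 2 / 16` of `gEta`.
    have h6 : (1 - x) ^ 2 ≤ η ^ 2 / 16 := by
      have h7 : |1 - x| ≤ η / 4 := by
        have h8 : |c - y| ≤ (q - 1) / 2 * √a := by
          rw [_root_.abs_le, hc]
          constructor <;> nlinarith
        have h9 : |1 - x| * c = |c - y| := by
          rw [← abs_of_pos hc0, ← abs_mul, abs_of_pos hc0, hyx]; congr 1; ring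
        rw [← mul_le_mul_iff_left₀ hc0, h9]
        refine h8.trans ?_
        have h10 : η = (q - 1) * (q + 1) := by linarith [hq2, show (q-1)*(q+1) = q^2 - 1 by ring]
        rw [hc, h10]
        have h11 : (q - 1) / 2 * √a * 1 ≤ (q - 1) / 2 * √a * ((q + 1) ^ 2 / 4) := by
          gcongr
          nlinarith
        calc (q - 1) / 2 * √a = (q - 1) / 2 * √a * 1 := by ring
          _ ≤ _ := h11
          _ = _ := by ring
      calc (1 - x) ^ 2 = |1 - x| ^ 2 := (sq_abs _).symm
        _ ≤ (η / 4) ^ 2 := by gcongr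
        _ = _ := by ring
    refine le_trans ?_ h5
    have h7 : g / 2 ≤ x - x ^ 2 / 2 := by
      rw [hg, gEta]; nlinarith
    calc ℓ = 2 * ℓ / g * (g / 2) := by field_simp
      _ ≤ d ^ 2 * (x - x ^ 2 / 2) := by rw [hd2]; gcongr
  refine (measure_mono hsub).trans ((meas_ge_le_lintegral_div
    (by fun_prop) (by simp [Real.exp_pos]) ENNReal.ofReal_ne_top).trans ?_)
  rw [Real.exp_neg, ENNReal.ofReal_inv_of_pos (Real.exp_pos _), ← one_div]
  gcongr
  exact hexp β

/-- Peeling over geometric cells. -/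
theorem measure_peel_le {σ η ℓ a : ℝ} (hσ : 0 < σ) (hη0 : 0 < η) (hη4 : η < 4) (hℓ : 0 ≤ ℓ)
    (ha : 0 < a) {Z V Y : Ω → ℝ} (hZ : Measurable Z) (hV : Measurable V)
    (hexp : ∀ β, ∫⁻ ω, ENNReal.ofReal (Real.exp (β * Z ω - β ^ 2 * σ ^ 2 / 2 * V ω)) ∂μ ≤ 1)
    {E : Set Ω} (hE : ∀ ω ∈ E, V ω ≤ Y ω ∧ a ≤ Y ω ∧ σ * √(2 * ℓ / gEta η * Y ω) ≤ Z ω) (K : ℕ) :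
    μ (E ∩ {ω | Y ω < a * (1 + η) ^ K}) ≤ K * ENNReal.ofReal (Real.exp (-ℓ)) := by
  induction K with
  | zero =>
    have : E ∩ {ω | Y ω < a * (1 + η) ^ 0} = ∅ := by
      ext ω
      refine iff_of_false (fun h => ?_) (Set.notMem_empty ω)
      have h1 : Y ω < a * (1 + η) ^ 0 := h.2
      rw [pow_zero, mul_one] at h1
      exact (hE ω h.1).2.1.not_gt h1
    rw [this, measure_empty]
    exact zero_le
  | succ K ih =>
    have h1 : E ∩ {ω | Y ω < a * (1 + η) ^ (K + 1)} ⊆ (E ∩ {ω | Y ω < a * (1 + η) ^ K}) ∪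
        (E ∩ {ω | a * (1 + η) ^ K ≤ Y ω ∧ Y ω ≤ a * (1 + η) ^ K * (1 + η)}) := by
      rintro ω ⟨h2, h3⟩
      rcases lt_or_ge (Y ω) (a * (1 + η) ^ K) with h | h
      · exact Or.inl ⟨h2, h⟩
      · refine Or.inr ⟨h2, h, ?_⟩
        rw [mul_assoc, ← pow_succ]
        exact le_of_lt h3
    refine (measure_mono h1).trans ((measure_union_le _ _).trans ?_)
    push_cast
    rw [add_mul, one_mul]
    gcongr
    refine measure_cell_le (a := a * (1 + η) ^ K) hσ hη0 hη4 hℓ (by positivity) hZ hV hexp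
      (Y := Y) ?_
    rintro ω ⟨h2, h3, h4⟩
    exact ⟨(hE ω h2).1, h3, h4, (hE ω h2).2.2⟩

end Concentration

/-! ### Tail events of the indices -/

section Tail

variable {N M : ℕ}

/-- In the round-robin phase two agents share an arm in a round only if their ranks agree modulo
`N`; as `M ≤ N`, the agents visit the arm at different times. -/
theorem exists_init_round {r : Fin M → ℕ → Fin N} (hMN : M ≤ N)
    (hinit : ∀ n < N, ∀ k : Fin M, (r k n : ℕ) = (n + k) % N) (i : Fin N) :
    ∃ t : Fin M → ℕ, Function.Injective t ∧ (∀ j, t j < N) ∧ ∀ j, r j (t j) = i := by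
  have hN : 0 < N := i.pos
  have h1 : ∀ j : Fin M, ∃ t < N, (t + j) % N = i := by
    intro j
    refine ⟨(i + (N - j)) % N, Nat.mod_lt _ hN, ?_⟩
    rw [Nat.mod_add_mod, add_assoc, Nat.sub_add_cancel (by omega), Nat.add_mod_right,
      Nat.mod_eq_of_lt i.2]
  choose t ht hti using h1
  refine ⟨t, fun a c hac => ?_, ht, fun j => Fin.ext ?_⟩
  · have h2 : (t a + a) ≡ (t a + c) [MOD N] := by
      have := (hti a).trans (hti c).symm
      rwa [← hac] at this
    have h3 := Nat.ModEq.add_left_cancel' _ h2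
    exact Fin.ext (h3.eq_of_lt_of_lt (by omega) (by omega))
  · rw [hinit _ (ht j), hti]

theorem sum_init_le {r : Fin M → ℕ → Fin N}
    (hinit : ∀ n < N, ∀ k : Fin M, (r k n : ℕ) = (n + k) % N) (i : Fin N) :
    ∑ τ ∈ Finset.range N, ∑ j, (if r j τ = i then (1 : ℝ) else 0) ≤ M := by
  rw [Finset.sum_comm]
  calc ∑ j, ∑ τ ∈ Finset.range N, (if r j τ = i then (1 : ℝ) else 0) ≤ ∑ _j : Fin M, (1 : ℝ) := by
        refine Finset.sum_le_sum fun j _ => ?_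
        rw [Finset.sum_boole]
        have : (Finset.filter (fun τ => r j τ = i) (Finset.range N)).card ≤ 1 := by
          refine Finset.card_le_one.2 fun a ha c hc => ?_
          simp only [Finset.mem_filter, Finset.mem_range] at ha hc
          have h1 := hinit a ha.1 j
          have h2 := hinit c hc.1 j
          rw [ha.2] at h1
          rw [hc.2] at h2
          have h3 : (a + j) ≡ (c + j) [MOD N] := h1.symm.trans h2
          exact (Nat.ModEq.add_right_cancel' _ h3).eq_of_lt_of_lt ha.1 hc.1
        exact_mod_cast this
    _ = M := by simp

variable {Ω : Type*} [mΩ : MeasurableSpace Ω] {μ : Measure Ω}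
  {P : Matrix (Fin M) (Fin M) ℝ} {lam : Fin M → ℝ} {u : Fin M → Fin M → ℝ} {z : Fin M}
  {r : ℕ → Fin N → Fin M → Ω → ℝ} {sel : ℕ → Fin M → Ω → Fin N}

theorem measurable_nHat (hr : ∀ n i k, Measurable (r n i k)) (hsel : DependsOnPast r sel)
    (i : Fin N) (n : ℕ) (k : Fin M) :
    Measurable fun ω => nHat P (fun n k => sel n k ω) i n k := by
  simp only [nHat_eq]
  refine Finset.measurable_sum _ fun τ _ => Finset.measurable_sum _ fun j _ => ?_
  exact measurable_const.mul (Measurable.ite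
    (measurable_sel hr hsel τ j (measurableSet_singleton i)) measurable_const measurable_const)

theorem measurable_sHat (hr : ∀ n i k, Measurable (r n i k)) (hsel : DependsOnPast r sel)
    (i : Fin N) (n : ℕ) (k : Fin M) :
    Measurable fun ω => sHat P (fun n i k => r n i k ω) (fun n k => sel n k ω) i n k := by
  simp only [sHat_eq]
  refine Finset.measurable_sum _ fun τ _ => Finset.measurable_sum _ fun j _ => ?_
  exact measurable_const.mul ((hr τ i j).mul (Measurable.ite
    (measurable_sel hr hsel τ j (measurableSet_singleton i)) measurable_const measurable_const))

/-- The event that the estimate of agent `k` of the mean of arm `i` errs by more than the confidence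
width, upwards for `s = 1` and downwards for `s = -1`. -/
def deviation (P : Matrix (Fin M) (Fin M) ℝ) (σ γ η : ℝ) (f : ℝ → ℝ)
    (r : ℕ → Fin N → Fin M → Ω → ℝ) (sel : ℕ → Fin M → Ω → Fin N) (m : Fin N → ℝ) (n : ℕ)
    (k : Fin M) (i : Fin N) (s : ℝ) : Set Ω :=
  {ω | nHat P (fun n k => sel n k ω) i n k ≠ 0 ∧
    confWidth M σ γ η f n (nHat P (fun n k => sel n k ω) i n k) ≤
      s * (sHat P (fun n i k => r n i k ω) (fun n k => sel n k ω) i n k /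
        nHat P (fun n k => sel n k ω) i n k - m i)}

theorem measurableSet_deviation (hr : ∀ n i k, Measurable (r n i k)) (hsel : DependsOnPast r sel)
    (σ γ η : ℝ) (f : ℝ → ℝ) (m : Fin N → ℝ) (n : ℕ) (k : Fin M) (i : Fin N) (s : ℝ) :
    MeasurableSet (deviation P σ γ η f r sel m n k i s) := by
  have h1 := measurable_nHat (P := P) hr hsel i n k
  have h2 := measurable_sHat (P := P) hr hsel i n k
  have h3 : MeasurableSet {ω | confWidth M σ γ η f n (nHat P (fun n k => sel n k ω) i n k) ≤
      s * (sHat P (fun n i k => r n i k ω) (fun n k => sel n k ω) i n k /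
        nHat P (fun n k => sel n k ω) i n k - m i)} := by
    refine measurableSet_le ?_ ?_
    · unfold confWidth
      fun_prop
    · fun_prop
  exact (h1 (measurableSet_singleton 0).compl).inter h3

/-- Self-normalized tail bound for the cooperative estimates. -/
theorem measure_deviation_le [IsProbabilityMeasure μ] (h : IsStochasticSpectrum P lam u z)
    (hN : 2 ≤ N) (hMN : M ≤ N) {σ γ η : ℝ} (hσ : 0 < σ) (hγ : 1 < γ) (hη0 : 0 < η) (hη4 : η < 4)
    {f : ℝ → ℝ} {law : Fin N → Measure ℝ} (hlaw : ∀ i, IsSubGaussianLaw (law i) σ)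
    {m : Fin N → ℝ} (hm : ∀ i, m i = ∫ x, x ∂(law i)) (hr : ∀ n i k, Measurable (r n i k))
    (hr_law : ∀ n i k, μ.map (r n i k) = law i)
    (hind : iIndepFun (fun (q : ℕ × Fin M) ω i => r q.1 i q.2 ω) μ) (hsel : DependsOnPast r sel)
    (hinit : ∀ ω, ∀ n < N, ∀ k : Fin M, (sel n k ω : ℕ) = (n + k) % N) {n : ℕ} (hn : N ≤ n)
    {k : Fin M} (hf : epsC lam u k ≤ f n) (i : Fin N) {s : ℝ} (hs : s ^ 2 = 1) :
    μ (deviation P σ γ η f r sel m n k i s) ≤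
      ENNReal.ofReal ((2 * Real.log n / Real.log (1 + η) + 1) * (1 / (n : ℝ) ^ γ)) := by
  have hM : (0 : ℝ) < M := by exact_mod_cast k.pos
  have hn2 : (2 : ℝ) ≤ n := by exact_mod_cast hN.trans hn
  have hl : 0 < Real.log (1 + η) := Real.log_pos (by linarith)
  have hln : 0 ≤ Real.log n := Real.log_natCast_nonneg n
  let w : ℕ → Fin M → ℝ := fun τ j => (P ^ (n - τ)) k j
  let ξ : Ω → ℕ → Fin M → ℝ := fun ω τ j => if sel τ j ω = i then 1 else 0
  have hξ0 : ∀ ω τ j, 0 ≤ ξ ω τ j := fun ω τ j => by simp only [ξ]; split_ifs <;> simp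
  have hξ1 : ∀ ω τ j, ξ ω τ j ≤ 1 := fun ω τ j => by simp only [ξ]; split_ifs <;> simp
  have hξm : ∀ τ j, Measurable fun ω => ξ ω τ j := fun τ j => Measurable.ite
    (measurable_sel hr hsel τ j (measurableSet_singleton i)) measurable_const measurable_const
  let Z : Ω → ℝ := fun ω => ∑ τ ∈ Finset.range n, ∑ j, w τ j * (r τ i j ω - m i) * ξ ω τ j
  let V : Ω → ℝ := fun ω => ∑ τ ∈ Finset.range n, ∑ j, w τ j ^ 2 * ξ ω τ j
  let X : Ω → ℝ := fun ω => nHat P (fun n k => sel n k ω) i n k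
  let Y : Ω → ℝ := fun ω => (X ω + f n) / M
  have hX : ∀ ω, X ω = ∑ τ ∈ Finset.range n, ∑ j, w τ j * ξ ω τ j := fun ω => nHat_eq _ _ _ _ _
  have hZm : Measurable Z := Finset.measurable_sum _ fun τ _ => Finset.measurable_sum _ fun j _ =>
    ((((hr τ i j).sub_const _).const_mul _).mul (hξm τ j))
  have hVm : Measurable V := Finset.measurable_sum _ fun τ _ => Finset.measurable_sum _ fun j _ =>
    (hξm τ j).const_mul _
  have hZ : ∀ ω, Z ω = sHat P (fun n i k => r n i k ω) (fun n k => sel n k ω) i n k - m i * X ω := by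
    intro ω
    rw [sHat_eq, hX, Finset.mul_sum, ← Finset.sum_sub_distrib]
    refine Finset.sum_congr rfl fun τ _ => ?_
    rw [Finset.mul_sum, ← Finset.sum_sub_distrib]
    refine Finset.sum_congr rfl fun j _ => ?_
    simp only [w, ξ]
    ring
  have hexp : ∀ β, ∫⁻ ω, ENNReal.ofReal
      (Real.exp (β * (s * Z ω) - β ^ 2 * σ ^ 2 / 2 * V ω)) ∂μ ≤ 1 := by
    intro β
    -- The sign `s` is absorbed into the parameter: `β * s` has the same square as `β`, so both
    -- tails have the same compensator.
    have := lintegral_exp_weighted_le hr hind hsel (hlaw i) (fun n k => hr_law n i k) w (β * s) n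
    simp only [← hm, mul_pow, hs, mul_one] at this
    simpa only [← mul_assoc] using this
  -- Lower end of the peeling range: `X ≥ 0` and `X ≥ 3/4 - epsC` with `epsC ≤ f n` give both halves
  -- of the maximum.
  set a : ℝ := max (3 / 4) (f n) / M with ha
  have hmax : (3 : ℝ) / 4 ≤ max (3 / 4) (f n) := le_max_left _ _
  have hmaxf : f n ≤ max (3 / 4) (f n) := le_max_right _ _
  have ha0 : 0 < a := by positivity
  -- Enough cells of ratio `1 + η` to cover the factor `n ^ 2`.
  set K : ℕ := ⌊2 * Real.log n / Real.log (1 + η)⌋₊ + 1 with hK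
  have hKle : (K : ℝ) ≤ 2 * Real.log n / Real.log (1 + η) + 1 := by
    rw [hK]; push_cast
    gcongr
    exact Nat.floor_le (by positivity)
  have hKpow : (n : ℝ) ^ 2 < (1 + η) ^ K := by
    rw [← Real.log_lt_log_iff (by positivity) (by positivity), Real.log_pow, Real.log_pow]
    have := Nat.lt_floor_add_one (2 * Real.log n / Real.log (1 + η))
    rw [div_lt_iff₀ hl] at this
    rw [hK]; push_cast at this ⊢
    exact this
  have hX0 : ∀ ω, 0 ≤ X ω := fun ω => by
    rw [hX]
    exact Finset.sum_nonneg fun τ _ => Finset.sum_nonneg fun j _ =>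
      mul_nonneg (h.pow_nonneg _ _ _) (hξ0 ω τ j)
  have hXn : ∀ ω, X ω ≤ n := fun ω => by rw [hX]; exact h.weighted_le (hξ1 ω) n k
  have hXge : ∀ ω, 3 / 4 - epsC lam u k ≤ X ω := fun ω => by
    obtain ⟨t, ht, htN, hti⟩ := exists_init_round (r := fun j n => sel n j ω) hMN (hinit ω) i
    rw [hX]
    exact h.weighted_ge (hξ0 ω) n k ht (fun j => (htN j).trans_le hn)
      (fun j => by simp only [ξ]; exact if_pos (hti j))
  have hE : ∀ ω ∈ deviation P σ γ η f r sel m n k i s,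
      V ω ≤ Y ω ∧ a ≤ Y ω ∧ σ * √(2 * (γ * Real.log n) / gEta η * Y ω) ≤ s * Z ω := by
    rintro ω ⟨h1, h2⟩
    have hXpos : 0 < X ω := lt_of_le_of_ne (hX0 ω) (Ne.symm h1)
    refine ⟨?_, ?_, ?_⟩
    · rw [le_div_iff₀ hM, mul_comm]
      refine (h.sum_sq_le (hξ0 ω) (hξ1 ω) n k).trans ?_
      rw [hX]
      gcongr
    · rw [ha]
      refine div_le_div_of_nonneg_right (max_le ?_ ?_) hM.le
      · linarith [hXge ω]
      · linarith
    · rw [← confWidth_mul hXpos, hZ]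
      calc confWidth M σ γ η f n (X ω) * X ω
          ≤ s * (sHat P (fun n i k => r n i k ω) (fun n k => sel n k ω) i n k / X ω - m i) * X ω := by
            gcongr
        _ = _ := by field_simp
  have hYlt : ∀ ω, Y ω < a * (1 + η) ^ K := by
    intro ω
    refine lt_of_le_of_lt ?_ (mul_lt_mul_of_pos_left hKpow ha0)
    rw [ha, div_mul_eq_mul_div]
    refine div_le_div_of_nonneg_right ?_ hM.le
    -- It suffices that `n ≤ 3/4 * (n ^ 2 - 1)`, which holds for `n ≥ 2`.
    have h1 : (3 : ℝ) / 4 * ((n : ℝ) ^ 2 - 1) ≤ max (3 / 4) (f n) * ((n : ℝ) ^ 2 - 1) := by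
      gcongr
      nlinarith
    nlinarith [hXn ω]
  have hfin := measure_peel_le hσ hη0 hη4 (ℓ := γ * Real.log n) (by positivity) ha0
    (hZm.const_mul s) hVm hexp hE K
  have hsub : deviation P σ γ η f r sel m n k i s ⊆
      deviation P σ γ η f r sel m n k i s ∩ {ω | Y ω < a * (1 + η) ^ K} :=
    fun ω hω => ⟨hω, hYlt ω⟩
  refine (measure_mono hsub).trans (hfin.trans ?_)
  rw [← ENNReal.ofReal_natCast, ← ENNReal.ofReal_mul (by positivity)]
  refine ENNReal.ofReal_le_ofReal ?_
  have hpow : Real.exp (-(γ * Real.log n)) = 1 / (n : ℝ) ^ γ := by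
    rw [Real.exp_neg, Real.rpow_def_of_pos (by linarith), one_div, mul_comm]
  rw [hpow]
  gcongr

end Tail

/-! ### Wrong selections -/

section Selection

/-- If arm `i` has a small confidence width and is selected though it is not the arm of rank `c`,
then some estimate is outside of its confidence interval. -/
theorem IsSelectiveChoice.exists_deviation {N : ℕ} {m x s C : Fin N → ℝ} {Δ : ℝ}
    {b : Equiv.Perm (Fin N)} (hb : StrictAnti fun j => m (b j))
    (hΔ : ∀ i j, i ≠ j → Δ ≤ |m i - m j|) {c : Fin N} {i : Fin N} {Q W : Fin N → EReal}
    (hQ : ∀ j, Q j = if x j = 0 then ⊤ else ((s j + C j : ℝ) : EReal))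
    (hW : ∀ j, W j = if x j = 0 then ⊥ else ((s j - C j : ℝ) : EReal))
    (hch : IsSelectiveChoice ((c : ℕ) + 1) Q W i) (hxi : x i ≠ 0) (hCi : C i ≤ Δ / 2)
    (hne : i ≠ b c) :
    (m i < m (b c) → m i ≤ s i - C i ∨ ∃ j, x j ≠ 0 ∧ s j + C j ≤ m j) ∧
    (¬ m i < m (b c) → s i + C i ≤ m i ∨ ∃ j, x j ≠ 0 ∧ m j ≤ s j - C j) := by
  obtain ⟨O, hcard, hO, hiO, hmin⟩ := hch
  have hmi : m i ≠ m (b c) := by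
    intro h
    have : m (b (b.symm i)) = m (b c) := by simpa using h
    exact hne (by rw [← hb.injective this]; simp)
  constructor
  · intro hlt
    -- There are `c + 1` arms at least as good as `b c`, and `O` has that many elements but contains
    -- the worse arm `i`; so a good arm is left out, and its `Q` is at most that of `i`. If no
    -- estimate erred, the gap would exceed twice the width of `i`, against this order.
    obtain ⟨j, hjc, hjO⟩ : ∃ j, m (b c) ≤ m j ∧ j ∉ O := by
      by_contra! hcon
      have hsub : (Finset.Iic c).map b.toEmbedding ⊆ O := by
        intro j hj
        obtain ⟨d, hd, rfl⟩ := Finset.mem_map.1 hj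
        exact hcon _ (hb.antitone (Finset.mem_Iic.1 hd))
      have heq := Finset.eq_of_subset_of_card_le hsub (by simp [hcard])
      rw [← heq] at hiO
      obtain ⟨d, hd, rfl⟩ := Finset.mem_map.1 hiO
      exact hlt.not_ge (hb.antitone (Finset.mem_Iic.1 hd))
    have hq := hO i hiO j hjO
    rw [hQ, hQ, if_neg hxi] at hq
    by_cases hxj : x j = 0
    · rw [if_pos hxj] at hq
      exact absurd (top_le_iff.1 hq) (EReal.coe_ne_top _)
    rw [if_neg hxj, EReal.coe_le_coe_iff] at hq
    by_contra! hcon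
    have h1 := hcon.2 j hxj
    have h2 := hΔ j i (by rintro rfl; linarith)
    rw [abs_of_pos (by linarith)] at h2
    linarith [hcon.1]
  · intro hlt
    have hgt : m (b c) < m i := lt_of_le_of_ne (not_lt.1 hlt) hmi.symm
    -- Only `c` arms are strictly better than `b c`, so `O` must contain an arm that is not;
    -- minimality of `W` at `i` then plays the role of the order of `Q`.
    obtain ⟨j, hjc, hjO⟩ : ∃ j, m j ≤ m (b c) ∧ j ∈ O := by
      by_contra! hcon
      have hsub : O ⊆ (Finset.Iio c).map b.toEmbedding := by
        intro j hj
        refine Finset.mem_map.2 ⟨b.symm j, Finset.mem_Iio.2 ?_, by simp⟩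
        by_contra! hcj
        refine hcon j ?_ hj
        have := hb.antitone hcj
        simpa using this
      have := Finset.card_le_card hsub
      simp [hcard] at this
    have hw := hmin j hjO
    rw [hW, hW, if_neg hxi] at hw
    by_cases hxj : x j = 0
    · rw [if_pos hxj] at hw
      exact absurd (le_bot_iff.1 hw) (EReal.coe_ne_bot _)
    rw [if_neg hxj, EReal.coe_le_coe_iff] at hw
    by_contra! hcon
    have h1 := hcon.2 j hxj
    have h2 := hΔ i j (by rintro rfl; linarith)
    rw [abs_of_pos (by linarith)] at h2
    linarith [hcon.1]

/-- Selections made while the total count is below `X` number at most `X + M`. -/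
theorem sum_ite_count_le {a : ℕ → ℝ} {N : ℕ} {M X : ℝ} (ha0 : ∀ n, 0 ≤ a n) (haM : ∀ n, a n ≤ M)
    (hX : 0 ≤ X) (hinit : ∑ τ ∈ Finset.range N, a τ ≤ M) (T : ℕ) :
    ∑ n ∈ Finset.range T, (if n < N ∨ ∑ τ ∈ Finset.range n, a τ < X then a n else 0) ≤ X + M := by
  induction T with
  | zero => simpa using add_nonneg hX ((ha0 0).trans (haM 0))
  | succ T ih =>
    have hle : ∀ T, ∑ n ∈ Finset.range T,
        (if n < N ∨ ∑ τ ∈ Finset.range n, a τ < X then a n else 0) ≤ ∑ n ∈ Finset.range T, a n :=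
      fun T => Finset.sum_le_sum fun n _ => by split_ifs <;> simp [ha0]
    rcases lt_or_ge T N with hT | hT
    · refine (hle _).trans (le_trans ?_ (hinit.trans (by linarith)))
      exact Finset.sum_le_sum_of_subset_of_nonneg (Finset.range_mono hT) fun n _ _ => ha0 n
    -- If round `T` is counted, the selections before it total less than `X`, and the round adds at
    -- most `M`.
    · rw [Finset.sum_range_succ]
      split_ifs with h
      · have h1 := h.resolve_left (by omega)
        linarith [hle T, haM T]
      · simpa using ih

theorem one_le_timeInv {f : ℝ → ℝ} {y : ℝ} (h : ∃ s, 1 ≤ s ∧ y ≤ f s) : 1 ≤ timeInv f y :=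
  le_csInf h fun _ hs => hs.1

/-- Few rounds `n` have `f n < y`. -/
theorem sum_ite_lt_le {f : ℝ → ℝ} (hf : StrictMonoOn f (Set.Ici 1)) {y : ℝ}
    (h : ∃ s, 1 ≤ s ∧ y ≤ f s) {N : ℕ} (hN : 2 ≤ N) (T : ℕ) :
    ∑ n ∈ Finset.range T, (if N ≤ n ∧ f n < y then (1 : ℝ) else 0) ≤ timeInv f y - 1 := by
  have h1 := one_le_timeInv h
  have hle : ∀ n : ℕ, N ≤ n → f n < y → (n : ℝ) ≤ timeInv f y := by
    intro n hn hfn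
    refine le_csInf h fun s hs => ?_
    by_contra! hsn
    have hn1 : (1 : ℝ) ≤ n := by exact_mod_cast (by omega : 1 ≤ n)
    exact (hs.2.trans (hf.monotoneOn hs.1 hn1 hsn.le)).not_gt hfn
  rw [Finset.sum_boole]
  -- Rounds start at `N ≥ 2`, so round `1` is not among them; this saves the unit in `timeInv f y -
  -- 1`.
  have hsub : Finset.filter (fun n : ℕ => N ≤ n ∧ f n < y) (Finset.range T)
      ⊆ Finset.Ioc 1 ⌊timeInv f y⌋₊ := by
    intro n hn
    simp only [Finset.mem_filter] at hn
    exact Finset.mem_Ioc.2 ⟨by omega, Nat.le_floor (hle n hn.2.1 hn.2.2)⟩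
  have hcard := Finset.card_le_card hsub
  rw [Nat.card_Ioc] at hcard
  have hfl : 1 ≤ ⌊timeInv f y⌋₊ := Nat.le_floor (by exact_mod_cast h1)
  calc ((Finset.filter (fun n : ℕ => N ≤ n ∧ f n < y) (Finset.range T)).card : ℝ)
      ≤ ((⌊timeInv f y⌋₊ - 1 : ℕ) : ℝ) := by exact_mod_cast hcard
    _ = (⌊timeInv f y⌋₊ : ℝ) - 1 := by rw [Nat.cast_sub hfl, Nat.cast_one]
    _ ≤ timeInv f y - 1 := by
        gcongr
        exact Nat.floor_le (by linarith)

end Selection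

/-! ### Expected number of wrong selections -/

section WrongSelections

variable {N M : ℕ} {Ω : Type*}

/-- The number of times that arm `i` is selected by an agent for which it is the wrong arm. -/
def wrongCount (best : Fin M → Fin N) (sel : ℕ → Fin M → Ω → Fin N) (T : ℕ) (i : Fin N) (ω : Ω) :
    ℝ :=
  ∑ n ∈ Finset.range T, ∑ k, if sel n k ω = i ∧ best k ≠ i then 1 else 0

open Classical in
/-- The estimation errors that can make agent `k`, whose target is the arm `a`, select arm `i` though
its confidence width is small. -/
def errorEvent (P : Matrix (Fin M) (Fin M) ℝ) (σ γ η : ℝ) (f : ℝ → ℝ)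
    (r : ℕ → Fin N → Fin M → Ω → ℝ) (sel : ℕ → Fin M → Ω → Fin N) (m : Fin N → ℝ) (n : ℕ)
    (k : Fin M) (a i : Fin N) : Set Ω :=
  let s : ℝ := if m i < m a then 1 else -1
  deviation P σ γ η f r sel m n k i s ∪ ⋃ j, deviation P σ γ η f r sel m n k j (-s)

variable {P : Matrix (Fin M) (Fin M) ℝ} {lam : Fin M → ℝ} {u : Fin M → Fin M → ℝ} {z : Fin M}
  {r : ℕ → Fin N → Fin M → Ω → ℝ} {sel : ℕ → Fin M → Ω → Fin N} {σ γ η : ℝ} {f : ℝ → ℝ}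
  {m : Fin N → ℝ} {b : Equiv.Perm (Fin N)}

/-- The sign in `errorEvent` records the direction: a too low-ranked arm must be overestimated or
some arm underestimated, and conversely for a too high-ranked arm. -/
theorem mem_errorEvent {Δ : ℝ} (hb : StrictAnti fun j => m (b j))
    (hΔ : ∀ i j, i ≠ j → Δ ≤ |m i - m j|) {ω : Ω} {n : ℕ} {k : Fin M} {c : Fin N}
    (hc : (c : ℕ) = k) {i : Fin N}
    (hch : IsSelectiveChoice ((k : ℕ) + 1)
      (upperIndex P σ γ η f (fun n i k => r n i k ω) (fun n k => sel n k ω) n k)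
      (lowerIndex P σ γ η f (fun n i k => r n i k ω) (fun n k => sel n k ω) n k) i)
    (hx : nHat P (fun n k => sel n k ω) i n k ≠ 0)
    (hC : confWidth M σ γ η f n (nHat P (fun n k => sel n k ω) i n k) ≤ Δ / 2) (hne : b c ≠ i) :
    ω ∈ errorEvent P σ γ η f r sel m n k (b c) i := by
  rw [← hc] at hch
  have h := hch.exists_deviation hb hΔ (fun j => rfl) (fun j => rfl) hx hC hne.symm
  rw [errorEvent]
  split_ifs with hlt
  · rcases h.1 hlt with h1 | ⟨j, hj, h1⟩
    · exact Or.inl ⟨hx, by linarith⟩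
    · exact Or.inr (Set.mem_iUnion.2 ⟨j, hj, by linarith⟩)
  · rcases h.2 hlt with h1 | ⟨j, hj, h1⟩
    · exact Or.inl ⟨hx, by linarith⟩
    · exact Or.inr (Set.mem_iUnion.2 ⟨j, hj, by linarith⟩)

open Classical in
/-- Pathwise bound on the number of wrong selections of an arm. -/
theorem wrongCount_le (h : IsStochasticSpectrum P lam u z) (hN : 2 ≤ N) (hMN : M ≤ N)
    (hσ : 0 < σ) (hγ : 0 < γ) (hη : 0 < gEta η)
    (hf_mono : StrictMonoOn f (Set.Ici 1)) (hf_nonneg : 0 ≤ f 1)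
    (hf_inv : ∀ k, ∃ s, 1 ≤ s ∧ epsC lam u k ≤ f s) {Δ : ℝ} (hΔ0 : 0 < Δ)
    (hb : StrictAnti fun j => m (b j)) (hΔ : ∀ i j, i ≠ j → Δ ≤ |m i - m j|) {ω : Ω}
    (hrun : IsSelectiveLearningRun P σ γ η f (fun n i k => r n i k ω) (fun n k => sel n k ω))
    (hε : 0 ≤ epsN lam) (T : ℕ) (i : Fin N) :
    wrongCount (fun k => b (Fin.castLE hMN k)) sel T i ω ≤
      4 * σ ^ 2 * γ / (Δ ^ 2 * gEta η) *
        (1 + √(1 + Δ ^ 2 * M * gEta η / (2 * σ ^ 2 * γ) * (f T / Real.log T))) * Real.log T +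
      M * (1 + epsN lam) + ∑ k, (timeInv f (epsC lam u k) - 1) +
      ∑ n ∈ Finset.Ico N T, ∑ k : Fin M, (if epsC lam u k ≤ f n then
        (errorEvent P σ γ η f r sel m n k (b (Fin.castLE hMN k)) i).indicator 1 ω else 0) := by
  have hM : 0 < M := z.pos
  set A := 4 * σ ^ 2 * γ / (Δ ^ 2 * gEta η) *
        (1 + √(1 + Δ ^ 2 * M * gEta η / (2 * σ ^ 2 * γ) * (f T / Real.log T))) * Real.log T with hA
  have hlT : 0 ≤ Real.log T := Real.log_natCast_nonneg T
  have hA0 : 0 ≤ A := by positivity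
  let ξ : ℕ → Fin M → ℝ := fun τ j => if sel τ j ω = i then 1 else 0
  have hξ0 : ∀ τ j, 0 ≤ ξ τ j := fun τ j => by simp only [ξ]; split_ifs <;> simp
  have hξ1 : ∀ τ j, ξ τ j ≤ 1 := fun τ j => by simp only [ξ]; split_ifs <;> simp
  let a : ℕ → ℝ := fun τ => ∑ j, ξ τ j
  have ha0 : ∀ τ, 0 ≤ a τ := fun τ => Finset.sum_nonneg fun j _ => hξ0 τ j
  have haM : ∀ τ, a τ ≤ M := fun τ => by
    calc a τ ≤ ∑ _j : Fin M, (1 : ℝ) := Finset.sum_le_sum fun j _ => hξ1 τ j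
      _ = M := by simp
  -- A wrong selection falls under one of three headings: the arm is still undersampled, `f n` is
  -- below the centrality index of the agent, or an estimate has erred.
  have hterm : ∀ n ∈ Finset.range T, ∀ k : Fin M,
      (if sel n k ω = i ∧ b (Fin.castLE hMN k) ≠ i then (1 : ℝ) else 0) ≤
      (if n < N ∨ ∑ τ ∈ Finset.range n, a τ < A + M * epsN lam then ξ n k else 0) +
      (if N ≤ n ∧ f n < epsC lam u k then 1 else 0) +
      (if N ≤ n then (if epsC lam u k ≤ f n then
        (errorEvent P σ γ η f r sel m n k (b (Fin.castLE hMN k)) i).indicator 1 ω else 0)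
        else 0) := by
    intro n hn k
    have hi0 : 0 ≤ (errorEvent P σ γ η f r sel m n k (b (Fin.castLE hMN k)) i).indicator
        (1 : Ω → ℝ) ω := Set.indicator_nonneg (fun _ _ => zero_le_one) ω
    by_cases hsel : sel n k ω = i ∧ b (Fin.castLE hMN k) ≠ i
    swap
    · rw [if_neg hsel]
      have h1 := hξ0 n k
      positivity
    rw [if_pos hsel]
    have hξ : ξ n k = 1 := if_pos hsel.1
    by_cases h1 : n < N ∨ ∑ τ ∈ Finset.range n, a τ < A + M * epsN lam
    · rw [if_pos h1, hξ]
      have h2 : (0 : ℝ) ≤ (if N ≤ n ∧ f n < epsC lam u k then 1 else 0) := by positivity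
      have h3 : (0 : ℝ) ≤ (if N ≤ n then (if epsC lam u k ≤ f n then
        (errorEvent P σ γ η f r sel m n k (b (Fin.castLE hMN k)) i).indicator 1 ω else 0)
        else 0) := by positivity
      linarith
    push Not at h1
    rw [if_neg (by push Not; exact h1), zero_add]
    by_cases h2 : f n < epsC lam u k
    · rw [if_pos ⟨h1.1, h2⟩]
      have h3 : (0 : ℝ) ≤ (if N ≤ n then (if epsC lam u k ≤ f n then
        (errorEvent P σ γ η f r sel m n k (b (Fin.castLE hMN k)) i).indicator 1 ω else 0)
        else 0) := by positivity
      linarith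
    rw [if_neg (fun h => h2 h.2), zero_add, if_pos h1.1, if_pos (not_lt.1 h2)]
    have hnT : (n : ℝ) ≤ T := by exact_mod_cast (Finset.mem_range.1 hn).le
    have hn1 : (1 : ℝ) ≤ n := by exact_mod_cast (by omega : 1 ≤ n)
    have hT1 : (1 : ℝ) < T := by
      exact_mod_cast (by have := Finset.mem_range.1 hn; omega : 1 < T)
    have hthr : A ≤ M * nHat P (fun n k => sel n k ω) i n k := by
      have h3 := h.average_le hξ0 hξ1 n k
      have h4 : nHat P (fun n k => sel n k ω) i n k
          = ∑ τ ∈ Finset.range n, ∑ j, (P ^ (n - τ)) k j * ξ τ j := nHat_eq _ _ _ _ _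
      rw [← h4, mul_add] at h3
      have h5 : A + M * epsN lam ≤ ∑ τ ∈ Finset.range n, ∑ j, ξ τ j := h1.2
      linarith
    obtain ⟨hx, hC⟩ := confWidth_le (f := f) (n := n) (F := f T) hM hσ hγ hη hΔ0 (Real.log_pos hT1)
      (Real.log_le_log (by linarith) hnT)
      (hf_nonneg.trans (hf_mono.monotoneOn (Set.mem_Ici.2 le_rfl) hn1 hn1))
      (hf_mono.monotoneOn hn1 (hn1.trans hnT) hnT) hthr
    have hmem := mem_errorEvent (sel := sel) (r := r) (n := n) (c := Fin.castLE hMN k) hb hΔ rfl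
      (hsel.1 ▸ hrun.select n h1.1 k) hx.ne' hC hsel.2
    rw [Set.indicator_of_mem hmem]
    rfl
  have hinit : ∑ τ ∈ Finset.range N, a τ ≤ M :=
    sum_init_le (r := fun j n => sel n j ω) hrun.init i
  have hpart1 := sum_ite_count_le ha0 haM (X := A + M * epsN lam) (by positivity) hinit T
  calc wrongCount (fun k => b (Fin.castLE hMN k)) sel T i ω
      ≤ ∑ n ∈ Finset.range T, ∑ k : Fin M,
        ((if n < N ∨ ∑ τ ∈ Finset.range n, a τ < A + M * epsN lam then ξ n k else 0) +
        (if N ≤ n ∧ f n < epsC lam u k then 1 else 0) +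
        (if N ≤ n then (if epsC lam u k ≤ f n then
          (errorEvent P σ γ η f r sel m n k (b (Fin.castLE hMN k)) i).indicator 1 ω else 0)
          else 0)) :=
        Finset.sum_le_sum fun n hn => Finset.sum_le_sum fun k _ => hterm n hn k
    _ = ∑ n ∈ Finset.range T,
          (if n < N ∨ ∑ τ ∈ Finset.range n, a τ < A + M * epsN lam then a n else 0) +
        ∑ k : Fin M, ∑ n ∈ Finset.range T, (if N ≤ n ∧ f n < epsC lam u k then (1 : ℝ) else 0) +
        ∑ n ∈ Finset.Ico N T, ∑ k : Fin M, (if epsC lam u k ≤ f n then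
          (errorEvent P σ γ η f r sel m n k (b (Fin.castLE hMN k)) i).indicator 1 ω else 0) := by
        simp only [Finset.sum_add_distrib]
        congr 1
        · congr 1
          · refine Finset.sum_congr rfl fun n _ => ?_
            split_ifs <;> simp [a]
          · rw [Finset.sum_comm]
        · have h1 : Finset.Ico N T = Finset.filter (fun n => N ≤ n) (Finset.range T) := by
            ext n; simp [and_comm]
          rw [h1, Finset.sum_filter]
          refine Finset.sum_congr rfl fun n _ => ?_
          split_ifs <;> simp
    _ ≤ _ := by
        have h2 : ∑ k : Fin M, ∑ n ∈ Finset.range T,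
            (if N ≤ n ∧ f n < epsC lam u k then (1 : ℝ) else 0)
            ≤ ∑ k, (timeInv f (epsC lam u k) - 1) :=
          Finset.sum_le_sum fun k _ => sum_ite_lt_le hf_mono (hf_inv k) hN T
        linarith

theorem IsStochasticSpectrum.epsN_nonneg (h : IsStochasticSpectrum P lam u z) : 0 ≤ epsN lam := by
  rw [epsN, filter_ne_zero_eq h.index_zero]
  refine mul_nonneg (Real.sqrt_nonneg _) (Finset.sum_nonneg fun p hp => ?_)
  have := h.abs_lt p (Finset.ne_of_mem_erase hp)
  exact div_nonneg (abs_nonneg _) (by linarith)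

variable [mΩ : MeasurableSpace Ω] {μ : Measure Ω}

theorem measurableSet_errorEvent (hr : ∀ n i k, Measurable (r n i k)) (hsel : DependsOnPast r sel)
    (σ γ η : ℝ) (f : ℝ → ℝ) (m : Fin N → ℝ) (n : ℕ) (k : Fin M) (a i : Fin N) :
    MeasurableSet (errorEvent P σ γ η f r sel m n k a i) :=
  (measurableSet_deviation hr hsel σ γ η f m n k i _).union
    (MeasurableSet.iUnion fun j => measurableSet_deviation hr hsel σ γ η f m n k j _)

theorem measurable_wrongCount (hr : ∀ n i k, Measurable (r n i k)) (hsel : DependsOnPast r sel)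
    (best : Fin M → Fin N) (T : ℕ) (i : Fin N) : Measurable (wrongCount best sel T i) := by
  refine Finset.measurable_sum _ fun n _ => Finset.measurable_sum _ fun k _ =>
    Measurable.ite ?_ measurable_const measurable_const
  have h := measurable_sel hr hsel n k
  exact h (MeasurableSet.of_discrete (s := {x | x = i ∧ best k ≠ i}))

theorem integrable_wrongCount [IsProbabilityMeasure μ] (hr : ∀ n i k, Measurable (r n i k))
    (hsel : DependsOnPast r sel) (best : Fin M → Fin N) (T : ℕ) (i : Fin N) :
    Integrable (wrongCount best sel T i) μ := by
  refine Integrable.of_bound (measurable_wrongCount hr hsel best T i).aestronglyMeasurable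
    (T * M : ℝ) (Filter.Eventually.of_forall fun ω => ?_)
  have h0 : 0 ≤ wrongCount best sel T i ω :=
    Finset.sum_nonneg fun n _ => Finset.sum_nonneg fun k _ => by split_ifs <;> simp
  rw [Real.norm_of_nonneg h0]
  calc wrongCount best sel T i ω ≤ ∑ _n ∈ Finset.range T, ∑ _k : Fin M, (1 : ℝ) :=
        Finset.sum_le_sum fun n _ => Finset.sum_le_sum fun k _ => by split_ifs <;> simp
    _ = T * M := by simp

theorem integral_wrongCount_le [IsProbabilityMeasure μ] (h : IsStochasticSpectrum P lam u z)
    (hN : 2 ≤ N) (hMN : M ≤ N) (hσ : 0 < σ) (hγ : 1 < γ) (hη0 : 0 < η) (hη4 : η < 4)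
    (hf_mono : StrictMonoOn f (Set.Ici 1)) (hf_nonneg : 0 ≤ f 1)
    (hf_inv : ∀ k, ∃ s, 1 ≤ s ∧ epsC lam u k ≤ f s) {law : Fin N → Measure ℝ}
    (hlaw : ∀ i, IsSubGaussianLaw (law i) σ) (hm : ∀ i, m i = ∫ x, x ∂(law i))
    (hb : StrictAnti fun j => m (b j)) (hr : ∀ n i k, Measurable (r n i k))
    (hr_law : ∀ n i k, μ.map (r n i k) = law i)
    (hind : iIndepFun (fun (q : ℕ × Fin M) ω i => r q.1 i q.2 ω) μ) (hsel : DependsOnPast r sel)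
    (hrun : ∀ ω, IsSelectiveLearningRun P σ γ η f (fun n i k => r n i k ω) (fun n k => sel n k ω))
    (T : ℕ) (i : Fin N) :
    ∫ ω, wrongCount (fun k => b (Fin.castLE hMN k)) sel T i ω ∂μ ≤
      boundB N M σ γ η f (minGap m) (epsN lam) (fun k => timeInv f (epsC lam u k)) T := by
  classical
  have hε := h.epsN_nonneg
  have hl : 0 < Real.log (1 + η) := Real.log_pos (by linarith)
  have hminj : Function.Injective m := fun i j hij => by
    have : m (b (b.symm i)) = m (b (b.symm j)) := by simpa using hij
    exact b.symm.injective (hb.injective this)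
  obtain ⟨hΔ0, hΔ⟩ := minGap_spec hN hminj
  let p : ℕ → ℝ := fun n => (2 * Real.log n / Real.log (1 + η) + 1) * (1 / (n : ℝ) ^ γ)
  have hp0 : ∀ n, 0 ≤ p n := fun n => by
    have := Real.log_natCast_nonneg n
    simp only [p]
    positivity
  have herr : ∀ n ∈ Finset.Ico N T, ∀ k, epsC lam u k ≤ f n →
      μ.real (errorEvent P σ γ η f r sel m n k (b (Fin.castLE hMN k)) i) ≤ (N + 1) * p n := by
    intro n hn k hfk
    have hd : ∀ j (s : ℝ), s ^ 2 = 1 → μ.real (deviation P σ γ η f r sel m n k j s) ≤ p n :=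
      fun j s hs => ENNReal.toReal_le_of_le_ofReal (hp0 n)
        (measure_deviation_le h hN hMN hσ hγ hη0 hη4 hlaw hm hr hr_law hind hsel
          (fun ω => (hrun ω).init) (Finset.mem_Ico.1 hn).1 hfk j hs)
    have hs : ∀ q : Prop, (if q then (1 : ℝ) else -1) ^ 2 = 1 := fun q => by
      split_ifs <;> norm_num
    refine (measureReal_union_le _ _).trans ?_
    have h1 := hd i _ (hs (m i < m (b (Fin.castLE hMN k))))
    have h2 : μ.real (⋃ j, deviation P σ γ η f r sel m n k j
        (-(if m i < m (b (Fin.castLE hMN k)) then (1 : ℝ) else -1))) ≤ N * p n := by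
      refine (measureReal_iUnion_fintype_le _).trans ?_
      calc _ ≤ ∑ _j : Fin N, p n :=
            Finset.sum_le_sum fun j _ => hd j _ (by rw [neg_sq]; exact hs _)
        _ = N * p n := by simp
    rw [add_mul, one_mul, add_comm]
    exact add_le_add h2 h1
  have hE := measurableSet_errorEvent (P := P) hr hsel σ γ η f m
  have hint : ∀ n : ℕ, ∀ k : Fin M, Integrable (fun ω => if epsC lam u k ≤ f n then
        (errorEvent P σ γ η f r sel m n k (b (Fin.castLE hMN k)) i).indicator (1 : Ω → ℝ) ω
        else 0) μ := by
    intro n k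
    split_ifs
    · exact (integrable_const (1 : ℝ)).indicator (hE n k _ i)
    · exact integrable_zero _ _ _
  have hmono := integral_mono (integrable_wrongCount hr hsel _ T i)
    ((integrable_const _).add (integrable_finsetSum _ fun n _ => integrable_finsetSum _ fun k _ =>
      hint n k))
    (fun ω => wrongCount_le h hN hMN hσ (by linarith) (gEta_pos hη0 hη4) hf_mono hf_nonneg hf_inv
      hΔ0 hb hΔ (hrun ω) hε T i)
  refine hmono.trans ?_
  simp only [Pi.add_apply]
  rw [integral_add (integrable_const _) (integrable_finsetSum _ fun n _ =>
    integrable_finsetSum _ fun k _ => hint n k), integral_const, probReal_univ, one_smul,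
    integral_finsetSum _ fun n _ => integrable_finsetSum _ fun k _ => hint n k]
  have htail : ∑ n ∈ Finset.Ico N T, ∫ ω, ∑ k : Fin M, (if epsC lam u k ≤ f n then
        (errorEvent P σ γ η f r sel m n k (b (Fin.castLE hMN k)) i).indicator (1 : Ω → ℝ) ω
        else 0) ∂μ ≤ M * (N + 1) * ∑ n ∈ Finset.Ico N T, p n := by
    rw [Finset.mul_sum]
    refine Finset.sum_le_sum fun n hn => ?_
    rw [integral_finsetSum _ fun k _ => hint n k]
    calc _ ≤ ∑ _k : Fin M, (N + 1) * p n := by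
          refine Finset.sum_le_sum fun k _ => ?_
          split_ifs with hfk
          · rw [integral_indicator_one (hE n k _ i)]
            exact herr n hn k hfk
          · simpa using mul_nonneg (by positivity) (hp0 n)
      _ = M * (N + 1) * p n := by simp [mul_assoc]
  have hpeel := sum_peel_le hγ hη0 hN T
  -- The peeling bound has no `epsN` inside the logarithm, so it is weakened to the stated one; the
  -- summand `1` of `lBar` is slack as well.
  have hlog : Real.log (1 + η) ≤ Real.log ((1 + epsN lam) * (1 + η)) :=
    Real.log_le_log (by linarith) (le_mul_of_one_le_left (by linarith) (by linarith))
  have hfinal : M * (N + 1) * ∑ n ∈ Finset.Ico N T, p n ≤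
      2 * M * (N + 1) / Real.log (1 + η) *
      (1 / (γ - 1) ^ 2 + γ * Real.log ((1 + epsN lam) * (1 + η)) / (γ - 1) + 1) := by
    have hγ' : 0 < γ - 1 := by linarith
    calc M * (N + 1) * ∑ n ∈ Finset.Ico N T, p n
        ≤ M * (N + 1) * (2 / Real.log (1 + η) *
          (1 / (γ - 1) ^ 2 + γ * Real.log (1 + η) / (γ - 1) + 1)) := by gcongr
      _ ≤ M * (N + 1) * (2 / Real.log (1 + η) *
          (1 / (γ - 1) ^ 2 + γ * Real.log ((1 + epsN lam) * (1 + η)) / (γ - 1) + 1)) := by gcongr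
      _ = _ := by ring
  rw [boundB, lBar]
  linarith

end WrongSelections

/-! ### Regret -/

section Regret

variable {N M : ℕ} {Ω : Type*} {r : ℕ → Fin N → Fin M → Ω → ℝ} {sel : ℕ → Fin M → Ω → Fin N}
  {m : Fin N → ℝ} {best : Fin M → Fin N}

theorem soleInd_mem (s : ℕ → Fin M → Fin N) (n : ℕ) (k : Fin M) (i : Fin N) :
    0 ≤ soleInd s n k i ∧ soleInd s n k i ≤ 1 := by
  rw [soleInd]; split_ifs <;> simp

theorem sum_soleInd (s : ℕ → Fin M → Fin N) (n : ℕ) (k : Fin M) (c : Fin N → ℝ) :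
    ∑ i, c i * ((if s n k = i then 1 else 0) * soleInd s n k i)
      = c (s n k) * soleInd s n k (s n k) := by
  rw [Finset.sum_eq_single (s n k)]
  · simp
  · intro i _ hi; rw [if_neg hi.symm]; simp
  · simp

/-- The loss of a round is accounted for by the wrong selections. -/
theorem round_loss_le {best : Fin M → Fin N} (hbest : Function.Injective best) {top : ℝ}
    (hm0 : ∀ i, 0 ≤ m i) (htop : ∀ i, m i ≤ top) (s : ℕ → Fin M → Fin N) (n : ℕ) :
    ∑ k, (m (best k) - m (s n k) * soleInd s n k (s n k)) ≤
      top * ∑ i, ∑ k, (if s n k = i ∧ best k ≠ i then (1 : ℝ) else 0) +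
      ∑ k, m (best k) * ∑ j, (if s n j = best k ∧ best j ≠ best k then (1 : ℝ) else 0) := by
  rw [Finset.sum_comm, Finset.mul_sum, ← Finset.sum_add_distrib]
  refine Finset.sum_le_sum fun k _ => ?_
  have htop0 : 0 ≤ top := (hm0 (best k)).trans (htop _)
  have h0 : ∀ q : Prop, [Decidable q] → (0 : ℝ) ≤ if q then 1 else 0 := fun q _ => by
    split_ifs <;> simp
  have h1 : 0 ≤ ∑ i, (if s n k = i ∧ best k ≠ i then (1 : ℝ) else 0) :=
    Finset.sum_nonneg fun i _ => h0 _
  have h2 : 0 ≤ ∑ j, (if s n j = best k ∧ best j ≠ best k then (1 : ℝ) else 0) :=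
    Finset.sum_nonneg fun j _ => h0 _
  have h3 := mul_nonneg htop0 h1
  have h4 := mul_nonneg (hm0 (best k)) h2
  have h5 := mul_nonneg (hm0 (s n k)) (soleInd_mem s n k (s n k)).1
  -- On target the loss is zero unless another agent `j` collides; `j` has a different target, so it
  -- is counted in the second sum. Off target the first sum pays.
  by_cases hk : s n k = best k
  · by_cases hsole : ∀ j, j ≠ k → s n j ≠ s n k
    · have : soleInd s n k (s n k) = 1 := if_pos ⟨rfl, hsole⟩
      have h6 : m (s n k) * soleInd s n k (s n k) = m (best k) := by rw [this, mul_one, hk]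
      linarith
    · push Not at hsole
      obtain ⟨j, hjk, hj⟩ := hsole
      have h6 : 1 ≤ ∑ j, (if s n j = best k ∧ best j ≠ best k then (1 : ℝ) else 0) := by
        refine le_trans (le_of_eq ?_) (Finset.single_le_sum (fun j _ => h0 _) (Finset.mem_univ j))
        rw [if_pos ⟨hj.trans hk, hbest.ne hjk⟩]
      have := mul_le_mul_of_nonneg_left h6 (hm0 (best k))
      linarith
  · have h6 : 1 ≤ ∑ i, (if s n k = i ∧ best k ≠ i then (1 : ℝ) else 0) := by
      refine le_trans (le_of_eq ?_)
        (Finset.single_le_sum (fun i _ => h0 _) (Finset.mem_univ (s n k)))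
      rw [if_pos ⟨rfl, Ne.symm hk⟩]
    have := mul_le_mul_of_nonneg_left h6 htop0
    linarith [htop (best k)]

/-- Any function of the selections of round `n` is measurable with respect to the past. -/
theorem measurable_comp_sel (hsel : DependsOnPast r sel) (n : ℕ) (F : (Fin M → Fin N) → ℝ) :
    Measurable[rewardsIn r {q : ℕ × Fin M | q.1 < n}] fun ω => F fun k => sel n k ω := by
  let _ : MeasurableSpace Ω := rewardsIn r {q : ℕ × Fin M | q.1 < n}
  have h1 : Measurable fun ω k => sel n k ω :=
    measurable_pi_lambda _ fun k => (hsel n k).mono (pastRewards_le_rewardsIn n) le_rfl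
  exact (Measurable.of_discrete (f := F)).comp h1

variable [mΩ : MeasurableSpace Ω] {μ : Measure Ω}

theorem integrable_comp_sel [IsProbabilityMeasure μ] (hr : ∀ n i k, Measurable (r n i k)) (hsel : DependsOnPast r sel)
    (n : ℕ) (F : (Fin M → Fin N) → ℝ) : Integrable (fun ω => F fun k => sel n k ω) μ := by
  refine Integrable.of_bound
    ((measurable_comp_sel hsel n F).mono (rewardsIn_le hr _) le_rfl).aestronglyMeasurable
    (∑ x, |F x|) (Filter.Eventually.of_forall fun ω => ?_)
  exact Finset.single_le_sum (f := fun x => |F x|) (fun x _ => abs_nonneg _) (Finset.mem_univ _)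

theorem integrable_reward (hr : ∀ n i k, Measurable (r n i k)) {σ : ℝ} {law : Fin N → Measure ℝ}
    (hlaw : ∀ i, IsSubGaussianLaw (law i) σ) (hr_law : ∀ n i k, μ.map (r n i k) = law i) (n : ℕ)
    (i : Fin N) (k : Fin M) : Integrable (r n i k) μ := by
  have := (hlaw i).integrable
  rw [← hr_law n i k] at this
  exact this.comp_measurable (hr n i k)

/-- The expected reward equals the expected mean of the selected arm. -/
theorem integral_reward_eq [IsProbabilityMeasure μ] (hr : ∀ n i k, Measurable (r n i k)) {σ : ℝ} {law : Fin N → Measure ℝ}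
    (hlaw : ∀ i, IsSubGaussianLaw (law i) σ) (hm : ∀ i, m i = ∫ x, x ∂(law i))
    (hr_law : ∀ n i k, μ.map (r n i k) = law i)
    (hind : iIndepFun (fun (q : ℕ × Fin M) ω i => r q.1 i q.2 ω) μ) (hsel : DependsOnPast r sel)
    (n : ℕ) (k : Fin M) :
    ∫ ω, ∑ i, r n i k ω * (if sel n k ω = i then 1 else 0) *
      soleInd (fun n k => sel n k ω) n k i ∂μ
      = ∫ ω, m (sel n k ω) * soleInd (fun n k => sel n k ω) n k (sel n k ω) ∂μ := by
  -- `soleInd` uses only the selections of its own round, so it is a function of that profile; the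
  -- round index `0` is a dummy.
  let g : Fin N → (Fin M → Fin N) → ℝ := fun i x =>
    (if x k = i then 1 else 0) * soleInd (fun _ => x) 0 k i
  have hg : ∀ i ω, (if sel n k ω = i then 1 else 0) * soleInd (fun n k => sel n k ω) n k i
      = g i fun k => sel n k ω := fun i ω => rfl
  have hgi : ∀ i, Integrable (fun ω => g i fun k => sel n k ω) μ := fun i =>
    integrable_comp_sel hr hsel n (g i)
  -- The selections of all agents in round `n` depend only on earlier rounds, hence are independent
  -- of the reward vector of `(n, k)`. Independence between the arms of one vector is not needed.
  have hindep : ∀ i, IndepFun (r n i k) (fun ω => g i fun k => sel n k ω) μ := by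
    intro i
    rw [IndepFun_iff_Indep]
    refine indep_of_indep_of_le_left (indep_of_indep_of_le_right (indep_rewardsIn hr hind
      (S := {(n, k)}) (T := {q | q.1 < n}) ?_) ?_) ?_
    · rw [Set.disjoint_singleton_left]
      exact lt_irrefl n
    · exact (measurable_comp_sel hsel n (g i)).comap_le
    · exact (measurable_rewardsIn (q := (n, k)) (Set.mem_singleton _) i).comap_le
  have hri := integrable_reward hr hlaw hr_law n
  simp only [mul_assoc, hg]
  have hR : ∀ ω, m (sel n k ω) * soleInd (fun n k => sel n k ω) n k (sel n k ω)
      = ∑ i, m i * g i fun k => sel n k ω :=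
    fun ω => (sum_soleInd (fun n k => sel n k ω) n k m).symm
  simp only [hR]
  have hrg : ∀ i, Integrable (fun ω => r n i k ω * g i fun k => sel n k ω) μ := fun i =>
    (hindep i).integrable_mul (hri i k) (hgi i)
  rw [integral_finsetSum _ fun i _ => hrg i,
    integral_finsetSum _ fun i _ => (hgi i).const_mul _]
  refine Finset.sum_congr rfl fun i _ => ?_
  rw [(hindep i).integral_fun_mul_eq_mul_integral (hri i k).aestronglyMeasurable
    (hgi i).aestronglyMeasurable, integral_const_mul, hm, ← hr_law n i k,
    integral_map (f := fun x => x) (hr n i k).aemeasurable measurable_id.aestronglyMeasurable]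

theorem groupRegret_eq [IsProbabilityMeasure μ] (hr : ∀ n i k, Measurable (r n i k)) (hsel : DependsOnPast r sel)
    (best : Fin M → Fin N) (T : ℕ) :
    groupRegret μ m best sel T = ∑ n ∈ Finset.range T, ∑ k, (m (best k) -
      ∫ ω, m (sel n k ω) * soleInd (fun n k => sel n k ω) n k (sel n k ω) ∂μ) := by
  have hint : ∀ n k, Integrable (fun ω =>
      m (sel n k ω) * soleInd (fun n k => sel n k ω) n k (sel n k ω)) μ := fun n k =>
    integrable_comp_sel hr hsel n fun x => m (x k) * soleInd (fun _ => x) 0 k (x k)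
  rw [groupRegret, integral_finsetSum _ fun n _ => integrable_finsetSum _ fun k _ => hint n k]
  simp only [Finset.sum_sub_distrib]
  congr 1
  · simp
  · exact Finset.sum_congr rfl fun n _ => integral_finsetSum _ fun k _ => hint n k

theorem groupRegret_le [IsProbabilityMeasure μ] (hr : ∀ n i k, Measurable (r n i k)) (hsel : DependsOnPast r sel)
    {best : Fin M → Fin N} (hbest : Function.Injective best) {top : ℝ}
    (hm0 : ∀ i, 0 ≤ m i) (htop : ∀ i, m i ≤ top) (T : ℕ) :
    groupRegret μ m best sel T ≤ top * ∑ i, ∫ ω, wrongCount best sel T i ω ∂μ +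
      ∑ k, m (best k) * ∫ ω, wrongCount best sel T (best k) ω ∂μ := by
  have hint : ∀ n k, Integrable (fun ω =>
      m (sel n k ω) * soleInd (fun n k => sel n k ω) n k (sel n k ω)) μ := fun n k =>
    integrable_comp_sel hr hsel n fun x => m (x k) * soleInd (fun _ => x) 0 k (x k)
  have hint' : ∀ n k, Integrable (fun ω => m (best k) -
      m (sel n k ω) * soleInd (fun n k => sel n k ω) n k (sel n k ω)) μ := fun n k =>
    (integrable_const _).sub (hint n k)
  have hw := integrable_wrongCount (μ := μ) hr hsel best T
  have h1 : groupRegret μ m best sel T = ∫ ω, ∑ n ∈ Finset.range T, ∑ k, (m (best k) -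
      m (sel n k ω) * soleInd (fun n k => sel n k ω) n k (sel n k ω)) ∂μ := by
    rw [groupRegret_eq hr hsel,
      integral_finsetSum _ fun n _ => integrable_finsetSum _ fun k _ => hint' n k]
    refine Finset.sum_congr rfl fun n _ => ?_
    rw [integral_finsetSum _ fun k _ => hint' n k]
    refine Finset.sum_congr rfl fun k _ => ?_
    rw [integral_sub (integrable_const _) (hint n k), integral_const, probReal_univ, one_smul]
  have h2 : top * ∑ i, ∫ ω, wrongCount best sel T i ω ∂μ +
      ∑ k, m (best k) * ∫ ω, wrongCount best sel T (best k) ω ∂μ =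
      ∫ ω, (top * ∑ i, wrongCount best sel T i ω +
        ∑ k, m (best k) * wrongCount best sel T (best k) ω) ∂μ := by
    rw [integral_add ((integrable_finsetSum _ fun i _ => hw i).const_mul _)
      (integrable_finsetSum _ fun k _ => (hw (best k)).const_mul _), integral_const_mul,
      integral_finsetSum _ fun i _ => hw i,
      integral_finsetSum _ fun k _ => (hw (best k)).const_mul _]
    simp only [integral_const_mul]
  rw [h1, h2]
  refine integral_mono (integrable_finsetSum _ fun n _ => integrable_finsetSum _ fun k _ =>
      hint' n k) (((integrable_finsetSum _ fun i _ => hw i).const_mul _).add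
      (integrable_finsetSum _ fun k _ => (hw (best k)).const_mul _)) fun ω => ?_
  refine (Finset.sum_le_sum fun n _ =>
    round_loss_le hbest hm0 htop (fun n k => sel n k ω) n).trans (le_of_eq ?_)
  rw [Finset.sum_add_distrib, ← Finset.mul_sum]
  congr 1
  · rw [Finset.sum_comm]
    rfl
  · rw [Finset.sum_comm]
    refine Finset.sum_congr rfl fun k _ => ?_
    rw [← Finset.mul_sum]
    rfl

end Regret

end CoopBandit

/-! ### Assembly of the regret bound -/

theorem corollary2
    {Ω : Type*} [MeasurableSpace Ω] (μ : Measure Ω) [IsProbabilityMeasure μ]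
    -- `N` arms and `M ≤ N` agents
    {N M : ℕ} (hN : 2 ≤ N) (hMN : M ≤ N)
    -- connected communication graph, consensus matrix and its spectrum
    (G : SimpleGraph (Fin M)) [DecidableRel G.Adj] (hG : G.Connected)
    (κ : ℝ) (hκ0 : 0 < κ) (hκ1 : κ ≤ 1)
    (lam : Fin M → ℝ) (u : Fin M → Fin M → ℝ)
    (hspec : CoopBandit.IsEigenbasis (CoopBandit.consensusMatrix G κ) lam u)
    (hlam : ∀ p, -1 < lam p)
    -- parameters of the algorithm
    (σ γ η : ℝ) (hσ : 0 < σ) (hγ : 1 < γ) (hη0 : 0 < η) (hη4 : η < 4)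
    (f : ℝ → ℝ) (hf_mono : StrictMonoOn f (Set.Ici 1)) (hf_nonneg : 0 ≤ f 1)
    (hf_sublog : f =o[Filter.atTop] Real.log)
    (hf_inv : ∀ k, ∃ s, 1 ≤ s ∧ CoopBandit.epsC lam u k ≤ f s)
    -- reward distributions, with nonnegative and pairwise different means
    (law : Fin N → Measure ℝ) (hlaw : ∀ i, CoopBandit.IsSubGaussianLaw (law i) σ)
    (m : Fin N → ℝ) (hm : ∀ i, m i = ∫ x, x ∂(law i)) (hm_nonneg : ∀ i, 0 ≤ m i)
    (b : Equiv.Perm (Fin N)) (hb : StrictAnti fun j => m (b j))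
    -- rewards, independent over rounds and agents
    (r : ℕ → Fin N → Fin M → Ω → ℝ) (hr_meas : ∀ n i k, Measurable (r n i k))
    (hr_law : ∀ n i k, μ.map (r n i k) = law i)
    (hr_indep : iIndepFun (fun (q : ℕ × Fin M) ω i => r q.1 i q.2 ω) μ)
    -- selections made by the algorithm on the basis of the past
    (sel : ℕ → Fin M → Ω → Fin N)
    (hsel_past : CoopBandit.DependsOnPast r sel)
    (hsel : ∀ ω, CoopBandit.IsSelectiveLearningRun (CoopBandit.consensusMatrix G κ) σ γ η f
      (fun n i k => r n i k ω) (fun n k => sel n k ω))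
    (T : ℕ) (hT : 1 ≤ T) :
    let best : Fin M → Fin N := fun k => b (Fin.castLE hMN k)
    let B : ℝ := CoopBandit.boundB N M σ γ η f (CoopBandit.minGap m) (CoopBandit.epsN lam)
      (fun k => CoopBandit.timeInv f (CoopBandit.epsC lam u k)) T
    CoopBandit.groupRegret μ m best sel T ≤ ∑ k, CoopBandit.agentRegret μ m best r sel T k ∧
      ∑ k, CoopBandit.agentRegret μ m best r sel T k ≤
        m (b ⟨0, by omega⟩) * N * B + ∑ k, m (best k) * B := by
  intro best B
  have hb0 : 0 < M := hG.nonempty.elim fun k => k.pos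
  have hS := hspec.isStochasticSpectrum hG hκ0 hκ1 hlam (z := ⟨0, hb0⟩) rfl
  have hbest : Function.Injective best := b.injective.comp (Fin.castLE_injective hMN)
  have htop : ∀ i, m i ≤ m (b ⟨0, by omega⟩) := by
    intro i
    have := hb.antitone (Fin.le_def.2 (Nat.zero_le (b.symm i)) : (⟨0, by omega⟩ : Fin N) ≤ b.symm i)
    simpa using this
  have hcount : ∀ i, ∫ ω, CoopBandit.wrongCount best sel T i ω ∂μ ≤ B :=
    CoopBandit.integral_wrongCount_le hS hN hMN hσ hγ hη0 hη4 hf_mono hf_nonneg hf_inv hlaw hm hb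
      hr_meas hr_law hr_indep hsel_past hsel T
  -- The first inequality of the claim is in fact an equality.
  have heq : ∑ k, CoopBandit.agentRegret μ m best r sel T k
      = CoopBandit.groupRegret μ m best sel T := by
    rw [CoopBandit.groupRegret_eq hr_meas hsel_past, Finset.sum_comm]
    refine Finset.sum_congr rfl fun k _ => Finset.sum_congr rfl fun n _ => ?_
    rw [CoopBandit.integral_reward_eq hr_meas hlaw hm hr_law hr_indep hsel_past]
  rw [heq]
  refine ⟨le_rfl, (CoopBandit.groupRegret_le hr_meas hsel_past hbest hm_nonneg htop T).trans ?_⟩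
  have htop0 := hm_nonneg (b ⟨0, by omega⟩)
  gcongr ?_ + ?_
  · rw [mul_assoc]
    gcongr
    calc ∑ i, ∫ ω, CoopBandit.wrongCount best sel T i ω ∂μ ≤ ∑ _i : Fin N, B :=
          Finset.sum_le_sum fun i _ => hcount i
      _ = N * B := by simp
  · exact Finset.sum_le_sum fun k _ => mul_le_mul_of_nonneg_left (hcount _) (hm_nonneg _)
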